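/- Let $d\ge 2$. For $\mathbf a=(a_1,\dots,a_{d+1})\in\mathbb R^{d+1}$ and $\mathbf p=(p_1,\dots,p_{d+1})$ with $p_i>0$, $\sum_i p_i=1$ and $\sum_i p_ia_i=0$, let $X$ take the value $a_i$ with probability $p_i$ ($i=1,\dots,d+1$). Let $\sigma^2=\mathrm{Var}(X)$, $\phi(t)=\mathbb E(e^{itX})$, and $S_n=X_1+\dots+X_n$ with $X_j$ independent copies of $X$. Put $\mathfrak n(z)=\frac1{\sqrt{2\pi}}e^{-z^2/2}$ and $\mathfrak N(z)=\int_{-\infty}^z\mathfrak n(y)\,dy$. The order $r$ Edgeworth series of $S_n$ is the expression $$\mathcal E_r(z)=\mathfrak N(z)+\mathfrak n(z)\sum_{k=1}^r\frac{P_k(z)}{n^{k/2}},$$ where $P_1,\dots,P_r$ are real polynomials, not depending on $n$, such that for every $t\in\mathbb R$ $$\phi\Big(\frac{t}{\sigma\sqrt n}\Big)^n-\int_{\mathbb R}e^{itz}\,d\mathcal E_r(z)=o(n^{-r/2})\qquad(n\to\infty).$$ Let $d(s)=\max_{2\le j\le d+1}\mathrm{dist}\big((a_j-a_1)s,\,2\pi\mathbb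 Z\big)$, and call $\mathbf a$ $\beta$-Diophantine ($\beta\in\mathbb R$) if there is a constant $K>0$ such that $d(s)\ge K|s|^{-\beta}$ for all real $s$ with $|s|>1$. (0) If $a_1,\dots,a_{d+1}$ are not all equal, the polynomials $P_1,\dots,P_{d-1}$ defining $\mathcal E_{d-1}$ exist and are unique. (1) If $\mathbf a$ is $\beta$-Diophantine and $R\in\mathbb R$ satisfies $2\left(R-\frac12\right)\beta<1$, then $$\lim_{n\to\infty}n^R\left[\mathbb P\Big(\frac{S_n}{\sigma\sqrt n}\le z\Big)-\mathcal E_{d-1}(z)\right]=0\quad\text{uniformly in } z\in\mathbb R.$$ (2) Almost every $\mathbf a$ is $\beta$-Diophantine for every $\beta>\frac1{d-1}$. Moreover, for almost every $\mathbf a$ the order $d-1$ Edgeworth expansion is valid, that is, for every $z\in\mathbb R$ $$\lim_{n\to\infty}n^{(d-1)/2}\left[\mathbb P\Big(\frac{S_n}{\sigma\sqrt n}\le z\Big)-\mathcal E_{d-1}(z)\right]=0,$$ and for every $\varepsilon>0$ one has $\mathbb P\big(\frac{S_n}{\sigma\sqrt n}\le z\big)-\mathcal E_{d-1}(z)=o(n^{\varepsilon-d/2})$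 uniformly in $z\in\mathbb R$. Here "almost every $\mathbf a$" holds in both of the following senses: for Lebesgue-almost every $\mathbf a\in\mathbb R^{d+1}$, with the expansion holding for all $\mathbf p$ as above satisfying $\sum_ip_ia_i=0$; and, for each fixed $\mathbf p$ with $p_i>0$ and $\sum_ip_i=1$, for almost every $\mathbf a$ in the hyperplane $\{\mathbf a:\sum_ip_ia_i=0\}$ (with respect to Lebesgue measure on the hyperplane). -/

import Mathlib

open MeasureTheory ProbabilityTheory Filter Topology Asymptotics

noncomputable section

/-- The law of a random variable taking the value `a i` with probability `p i`. -/
def atomicLaw {m : ℕ} (a p : Fin m → ℝ) : Measure ℝ :=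
  ∑ i, ENNReal.ofReal (p i) • Measure.dirac (a i)

/-- The parameter set: positive weights with total mass one, and mean zero. -/
def IsCenteredParam {m : ℕ} (a p : Fin m → ℝ) : Prop :=
  (∀ i, 0 < p i) ∧ ∑ i, p i = 1 ∧ ∑ i, p i * a i = 0

/-- The vectors `a` for which the law with weights `p` has mean zero. -/
def meanZeroSubspace {m : ℕ} (p : Fin m → ℝ) : Submodule ℝ (Fin m → ℝ) :=
  LinearMap.ker (∑ i, p i • (LinearMap.proj i : (Fin m → ℝ) →ₗ[ℝ] ℝ))

/-- The standard deviation `σ` of a law on the real line. -/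
def stdDev (μ : Measure ℝ) : ℝ := √(variance id μ)

/-- `P(S_n / (σ √n) ≤ z)`, where `S_n = X_1 + ⋯ + X_n` with `X_j` independent of law `μ`. -/
def normalizedSumCDF (μ : Measure ℝ) (n : ℕ) (z : ℝ) : ℝ :=
  (Measure.pi fun _ : Fin n => μ).real {x | (∑ j, x j) / (stdDev μ * √(n : ℝ)) ≤ z}

/-- The standard normal distribution function. -/
def normalCDF (z : ℝ) : ℝ := ∫ y in Set.Iic z, gaussianPDFReal 0 1 y

/-- The expression `𝔑(z) + 𝔫(z) ∑_{k=1}^r P_k(z) / n^{k/2}`; `P k` is the polynomial with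
one-based index `k + 1`. -/
def edgeworthExpr {r : ℕ} (P : Fin r → Polynomial ℝ) (n : ℕ) (z : ℝ) : ℝ :=
  normalCDF z + gaussianPDFReal 0 1 z *
    ∑ k : Fin r, (P k).eval z / (n : ℝ) ^ ((((k : ℕ) : ℝ) + 1) / 2)

/-- The Fourier(–Stieltjes) transform `∫ e^{itz} dE(z)` of an Edgeworth expression. -/
def edgeworthFourier {r : ℕ} (P : Fin r → Polynomial ℝ) (n : ℕ) (t : ℝ) : ℂ :=
  ∫ z : ℝ, Complex.exp ((t : ℂ) * (z : ℂ) * Complex.I) *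
    ((deriv (edgeworthExpr P n) z : ℝ) : ℂ)

/-- `edgeworthExpr P` is the order `r` Edgeworth series of the normalized sums of independent
variables of law `μ`: for each `t`, `φ(t / (σ √n))^n` and the Fourier transform of the
expression differ by `o(n^{-r/2})`. -/
def IsEdgeworthSeries (μ : Measure ℝ) {r : ℕ} (P : Fin r → Polynomial ℝ) : Prop :=
  ∀ t : ℝ,
    (fun n : ℕ => charFun μ (t / (stdDev μ * √(n : ℝ))) ^ n - edgeworthFourier P n t)
      =o[atTop] (fun n : ℕ => (n : ℝ) ^ (-((r : ℝ) / 2)))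

/-- `n^ρ (P(S_n / (σ √n) ≤ z) - E_r(z)) → 0` uniformly in `z`. -/
def UniformEdgeworthError (μ : Measure ℝ) {r : ℕ} (P : Fin r → Polynomial ℝ) (ρ : ℝ) : Prop :=
  TendstoUniformly
    (fun (n : ℕ) (z : ℝ) => (n : ℝ) ^ ρ * (normalizedSumCDF μ n z - edgeworthExpr P n z))
    (fun _ => 0) atTop

/-- The order `r` Edgeworth expansion is valid: for every `z`,
`n^{r/2} (P(S_n / (σ √n) ≤ z) - E_r(z)) → 0`. -/
def EdgeworthExpansionValid (μ : Measure ℝ) {r : ℕ} (P : Fin r → Polynomial ℝ) : Prop :=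
  ∀ z : ℝ, Tendsto
    (fun n : ℕ => (n : ℝ) ^ ((r : ℝ) / 2) * (normalizedSumCDF μ n z - edgeworthExpr P n z))
    atTop (𝓝 0)

/-- `d(s) = max_j dist((a_j - a_1) s, 2πℤ)`, over the indices `j` other than the first. -/
def resonanceDist {d : ℕ} (a : Fin (d + 1) → ℝ) (s : ℝ) : ℝ :=
  ⨆ j : Fin d, Metric.infDist ((a j.succ - a 0) * s)
    (Set.range fun k : ℤ => 2 * Real.pi * (k : ℝ))

/-- `a` is `β`-Diophantine. -/
def IsDiophantine {d : ℕ} (β : ℝ) (a : Fin (d + 1) → ℝ) : Prop :=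
  ∃ K : ℝ, 0 < K ∧ ∀ s : ℝ, 1 < |s| → K / |s| ^ β ≤ resonanceDist a s

end

/-!
The characteristic function of the normalized sum at `t` is `φ(t / (σ √n)) ^ n`, and three ranges of
`t` behave differently.

*Low frequencies* `|t| ≤ δ √n`. With `x = i t` and `y = x / √n`, the cumulant expansion
`log M(y) = y² / 2 + y³ q(y) + O(y ^ (r + 3))` of the moment generating function, `q` a real
polynomial, gives `M(y) ^ n = exp (x² / 2) * exp (x² y q(y) + …)`. Expanding the second exponential
in powers of `y = x / √n` yields polynomials in `x` as coefficients, with an error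
`O((|t| / √n) ^ (r + 1) * exp (-t² / 4))` (`exists_mgf_pow_expansion`). Polynomials in `i t` times
`exp (-t² / 2)` are exactly the Fourier transforms of polynomials times the Gaussian density,
through Hermite polynomials (`gaussTransform_hermiteExpansion`, `hermiteExpansion_surjective`). This
gives existence and uniqueness of the Edgeworth series (`existsUnique_isEdgeworthSeries`).

*Middle frequencies* `δ √n ≤ |t| ≤ n ^ (R + ε)`. Here `|φ(s)| ≤ exp (-c d(s)²)`, and the Diophantine
condition makes `n d(s)²` at least a positive power of `n`, since `2 (R - 1 / 2) β < 1`
(`exists_norm_charFun_pow_le`).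

*High frequencies* are removed by smoothing with a Gaussian kernel of standard deviation slightly
below `n ^ (-R)`: its Fourier transform kills them, and the smoothing changes the distribution
functions by `o(n ^ (-R))` (`abs_measureReal_Iic_sub_le`, a Gaussian substitute for Esseen's
inequality).

The first omitted term of the expansion has size `n ^ (-d / 2)`. It is harmless as `R < d / 2`,
because Dirichlet's theorem on simultaneous approximation forces `β ≥ 1 / (d - 1)`
(`IsDiophantineFreq.one_le_mul`). Conversely, a Borel–Cantelli argument shows that almost every
vector is Diophantine for all exponents above `1 / (d - 1)` (`ae_isDiophantine_of_surjective`); the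
property depends on the differences `a_j - a_1` only, which are independent linear coordinates both
on the whole space and on the hyperplane of mean zero vectors, so one null set in the space of
differences serves for both. The results about generic vectors are then instances of the Diophantine
one.
-/

noncomputable section

/-! ### Diophantine properties of frequency vectors -/

/-- The sup-distance of the point `(b j * s)_j` of the line with direction `b` to the lattice
`(2πℤ)^ι`. -/
def latticeDist {ι : Type*} (b : ι → ℝ) (s : ℝ) : ℝ :=
  ⨆ j, Metric.infDist (b j * s) (Set.range fun k : ℤ => 2 * Real.pi * (k : ℝ))

lemma infDist_le_abs_sub (x : ℝ) (k : ℤ) :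
    Metric.infDist x (Set.range fun k : ℤ => 2 * Real.pi * (k : ℝ)) ≤ |x - 2 * Real.pi * k| :=
  Metric.infDist_le_dist_of_mem (Set.mem_range_self k)

lemma exists_abs_sub_eq_infDist (x : ℝ) : ∃ k : ℤ, |x - 2 * Real.pi * k| =
    Metric.infDist x (Set.range fun k : ℤ => 2 * Real.pi * (k : ℝ)) := by
  have hc : IsClosed (Set.range fun k : ℤ => 2 * Real.pi * (k : ℝ)) :=
    ((Homeomorph.mulLeft₀ (2 * Real.pi) (by positivity)).isClosedEmbedding.comp
      Int.isClosedEmbedding_coe_real).isClosed_range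
  obtain ⟨y, ⟨k, rfl⟩, hk⟩ := hc.exists_infDist_eq_dist ⟨_, Set.mem_range_self 0⟩ x
  exact ⟨k, hk.symm⟩

lemma latticeDist_le {ι : Type*} [Nonempty ι] {b : ι → ℝ} {s η : ℝ}
    (h : ∀ j, ∃ k : ℤ, |b j * s - 2 * Real.pi * k| ≤ η) : latticeDist b s ≤ η := by
  refine ciSup_le fun j => ?_
  obtain ⟨k, hk⟩ := h j
  exact (infDist_le_abs_sub _ k).trans hk

lemma latticeDist_nonneg {ι : Type*} (b : ι → ℝ) (s : ℝ) : 0 ≤ latticeDist b s :=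
  Real.iSup_nonneg fun _ => Metric.infDist_nonneg

section latticeDist

variable {ι : Type*} [Finite ι]

lemma infDist_le_latticeDist (b : ι → ℝ) (s : ℝ) (j : ι) :
    Metric.infDist (b j * s) (Set.range fun k : ℤ => 2 * Real.pi * (k : ℝ)) ≤ latticeDist b s :=
  le_ciSup (f := fun j => Metric.infDist (b j * s) (Set.range fun k : ℤ => 2 * Real.pi * (k : ℝ)))
    (Set.finite_range _).bddAbove j

lemma exists_abs_sub_le_latticeDist (b : ι → ℝ) (s : ℝ) (j : ι) :
    ∃ k : ℤ, |b j * s - 2 * Real.pi * k| ≤ latticeDist b s := by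
  obtain ⟨k, hk⟩ := exists_abs_sub_eq_infDist (b j * s)
  exact ⟨k, hk.trans_le (infDist_le_latticeDist b s j)⟩

lemma latticeDist_nat_mul_le [Nonempty ι] (b : ι → ℝ) (N : ℕ) (s : ℝ) :
    latticeDist b (N * s) ≤ N * latticeDist b s := by
  refine latticeDist_le fun j => ?_
  obtain ⟨k, hk⟩ := exists_abs_sub_le_latticeDist b s j
  refine ⟨N * k, ?_⟩
  have : b j * (N * s) - 2 * Real.pi * ((N * k : ℤ) : ℝ) = N * (b j * s - 2 * Real.pi * k) := by
    push_cast; ring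
  rw [this, abs_mul, Nat.abs_cast]
  gcongr

/-- A Diophantine lower bound at large `s` extends to all `s` away from `0`, since a multiple
`N * s` is large and its distance to the lattice is at most `N` times that of `s`. -/
lemma exists_le_latticeDist_of_large [Nonempty ι] {b : ι → ℝ} {β K S : ℝ} (hK : 0 < K)
    (h : ∀ s : ℝ, S < |s| → K / |s| ^ β ≤ latticeDist b s) {δ : ℝ} (hδ : 0 < δ) :
    ∃ K' : ℝ, 0 < K' ∧ ∀ s : ℝ, δ ≤ |s| → K' / |s| ^ β ≤ latticeDist b s := by
  obtain ⟨N, hN⟩ := exists_nat_gt (max (S / δ) 0)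
  have hN0 : (0 : ℝ) < N := (le_max_right _ _).trans_lt hN
  refine ⟨K / (N * (N : ℝ) ^ β), by positivity, fun s hs => ?_⟩
  have h1 : S < |N * s| := by
    rw [abs_mul, Nat.abs_cast]
    calc S < N * δ := by
          rw [← div_lt_iff₀ hδ]; exact (le_max_left _ _).trans_lt hN
      _ ≤ N * |s| := by gcongr
  have h2 := (h _ h1).trans (latticeDist_nat_mul_le b N s)
  rw [abs_mul, Nat.abs_cast, Real.mul_rpow hN0.le (abs_nonneg _)] at h2
  have hs' : 0 < |s| := hδ.trans_le hs
  have hs'' : (0 : ℝ) < |s| ^ β := by positivity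
  have hN'' : (0 : ℝ) < (N : ℝ) ^ β := by positivity
  rw [div_le_iff₀ (by positivity)] at h2 ⊢
  rw [div_le_iff₀ (by positivity)]
  linarith

end latticeDist

/-- The Diophantine condition in terms of the vector `b` of frequencies. -/
def IsDiophantineFreq {ι : Type*} (β : ℝ) (b : ι → ℝ) : Prop :=
  ∃ K : ℝ, 0 < K ∧ ∀ s : ℝ, 1 < |s| → K / |s| ^ β ≤ latticeDist b s

lemma isDiophantine_iff_freq {d : ℕ} {β : ℝ} {a : Fin (d + 1) → ℝ} :
    IsDiophantine β a ↔ IsDiophantineFreq β fun j : Fin d => a j.succ - a 0 := Iff.rfl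

lemma IsDiophantineFreq.mono {ι : Type*} {β β' : ℝ} (hβ : β ≤ β') {b : ι → ℝ}
    (h : IsDiophantineFreq β b) : IsDiophantineFreq β' b := by
  obtain ⟨K, hK, h⟩ := h
  refine ⟨K, hK, fun s hs => le_trans ?_ (h s hs)⟩
  have : 0 < |s| := by linarith
  have := Real.rpow_le_rpow_of_exponent_le hs.le hβ
  gcongr

lemma IsDiophantineFreq.exists_ne_zero {ι : Type*} [Finite ι] [Nonempty ι] {β : ℝ} {b : ι → ℝ}
    (h : IsDiophantineFreq β b) : ∃ j, b j ≠ 0 := by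
  by_contra! hb
  obtain ⟨K, hK, h⟩ := h
  have h2 := h 2 (by norm_num)
  have h3 : latticeDist b 2 ≤ 0 := latticeDist_le fun j => ⟨0, by simp [hb j]⟩
  have : 0 < K / |(2 : ℝ)| ^ β := by positivity
  linarith

/-- Simultaneous approximation of finitely many numbers, by the pigeonhole principle. -/
lemma exists_simultaneous_approx {κ : Type*} [Fintype κ] (x : κ → ℝ) {Q : ℕ} (hQ : 0 < Q) :
    ∃ k : ℕ, 0 < k ∧ k ≤ Q ^ Fintype.card κ ∧ ∀ j, ∃ l : ℤ, |k * x j - l| ≤ 1 / (Q : ℝ) := by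
  classical
  have hQ' : (0 : ℝ) < Q := by exact_mod_cast hQ
  have hlt (y : ℝ) : ⌊Q * Int.fract y⌋₊ < Q := by
    rw [Nat.floor_lt (by positivity)]
    nlinarith [Int.fract_lt_one y]
  let f : ℕ → κ → Fin Q := fun k j => ⟨⌊Q * Int.fract (k * x j)⌋₊, hlt _⟩
  obtain ⟨k₁, hk₁, k₂, hk₂, hne, hf⟩ := Finset.exists_ne_map_eq_of_card_lt_of_maps_to
    (s := Finset.range (Q ^ Fintype.card κ + 1)) (t := Finset.univ) (f := f) (by simp)
    (fun _ _ => Finset.mem_coe.2 (Finset.mem_univ _))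
  wlog hlt' : k₁ < k₂ generalizing k₁ k₂
  · exact this k₂ hk₂ k₁ hk₁ hne.symm hf.symm (by omega)
  refine ⟨k₂ - k₁, by omega, ?_, fun j => ?_⟩
  · simp only [Finset.mem_range] at hk₂; omega
  · refine ⟨⌊k₂ * x j⌋ - ⌊k₁ * x j⌋, ?_⟩
    have h1 := congrArg Fin.val (congrFun hf j)
    simp only [f] at h1
    have a1 := Nat.floor_le (a := Q * Int.fract (k₁ * x j)) (by positivity)
    have a2 := Nat.lt_floor_add_one (Q * Int.fract (k₁ * x j))
    have b1 := Nat.floor_le (a := Q * Int.fract (k₂ * x j)) (by positivity)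
    have b2 := Nat.lt_floor_add_one (Q * Int.fract (k₂ * x j))
    rw [h1] at a1 a2
    have e : (((k₂ - k₁ : ℕ) : ℝ)) * x j - ((⌊k₂ * x j⌋ - ⌊k₁ * x j⌋ : ℤ) : ℝ)
        = Int.fract (k₂ * x j) - Int.fract (k₁ * x j) := by
      push_cast [Nat.cast_sub hlt'.le, Int.fract]; ring
    rw [e, abs_le, ← neg_div, div_le_iff₀ hQ', le_div_iff₀ hQ']
    constructor <;> nlinarith

/-- The exponent in the Diophantine condition on `n` frequencies is at least `1 / (n - 1)`. -/
lemma IsDiophantineFreq.one_le_mul {ι : Type*} [Fintype ι] [Nonempty ι] {β : ℝ} {b : ι → ℝ}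
    (h : IsDiophantineFreq β b) : 1 ≤ ((Fintype.card ι : ℝ) - 1) * β := by
  classical
  have hcard1 : (1 : ℝ) ≤ Fintype.card ι := by exact_mod_cast Fintype.card_pos
  by_contra! hβ
  -- Enlarging a negative exponent to `0` keeps the assumption `hβ`.
  wlog hβ0 : 0 ≤ β generalizing β
  · exact this (h.mono (le_of_not_ge hβ0)) (by simp) le_rfl
  obtain ⟨i, hi⟩ := h.exists_ne_zero
  obtain ⟨K, hK, h⟩ := h
  have hbi : 0 < |b i| := abs_pos.2 hi
  set m := Fintype.card {j // j ≠ i} with hm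
  have hm' : (m : ℝ) = (Fintype.card ι : ℝ) - 1 := by
    rw [hm, Fintype.card_subtype_compl, Fintype.card_subtype_eq, Nat.cast_sub Fintype.card_pos]
    simp
  rw [← hm'] at hβ
  obtain ⟨M, hM⟩ := exists_nat_gt (|b i| / (2 * Real.pi))
  have hM0 : (0 : ℝ) < M := lt_of_le_of_lt (by positivity) hM
  rw [div_lt_iff₀ (by positivity)] at hM
  set c := 2 * Real.pi * M / |b i| with hc
  have hc1 : 1 < c := by rw [hc, lt_div_iff₀ hbi]; linarith
  have key : ∀ Q : ℕ, 0 < Q → (Q : ℝ) ^ (1 - m * β) ≤ 2 * Real.pi * M * c ^ β / K := by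
    intro Q hQ
    have hQ' : (0 : ℝ) < Q := by exact_mod_cast hQ
    obtain ⟨k, hk0, hkQ, hk⟩ := exists_simultaneous_approx (fun j : {j // j ≠ i} => b j / b i) hQ
    have hk1 : (1 : ℝ) ≤ k := by exact_mod_cast hk0
    set s := 2 * Real.pi * M * k / b i with hs
    have hsabs : |s| = c * k := by
      rw [hs, abs_div, abs_of_nonneg (by positivity)]; rw [hc]; ring
    have hd : latticeDist b s ≤ 2 * Real.pi * M / Q := by
      refine latticeDist_le fun j => ?_
      by_cases hj : j = i
      · subst hj
        refine ⟨M * k, ?_⟩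
        have : b j * s - 2 * Real.pi * ((M * k : ℤ) : ℝ) = 0 := by
          rw [hs]; push_cast; field_simp; ring
        rw [this, abs_zero]; positivity
      · obtain ⟨l, hl⟩ := hk ⟨j, hj⟩
        refine ⟨M * l, ?_⟩
        have : b j * s - 2 * Real.pi * ((M * l : ℤ) : ℝ)
            = 2 * Real.pi * M * (k * (b j / b i) - l) := by
          rw [hs]; push_cast; field_simp
        rw [this, abs_mul, abs_of_nonneg (by positivity), ← mul_one_div (2 * Real.pi * M)]
        exact mul_le_mul_of_nonneg_left hl (by positivity)
    have h1 : K / |s| ^ β ≤ 2 * Real.pi * M / Q := (h s (by rw [hsabs]; nlinarith)).trans hd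
    have h2 : |s| ^ β ≤ c ^ β * (Q : ℝ) ^ (m * β) := by
      rw [hsabs, Real.mul_rpow (by positivity) (by positivity)]
      gcongr
      rw [Real.rpow_mul hQ'.le, Real.rpow_natCast]
      exact Real.rpow_le_rpow (by positivity) (by exact_mod_cast hkQ) hβ0
    have hsp : 0 < |s| ^ β := by rw [hsabs]; positivity
    rw [div_le_div_iff₀ hsp hQ'] at h1
    rw [Real.rpow_sub hQ', Real.rpow_one, div_le_div_iff₀ (by positivity) hK, mul_comm]
    calc K * Q ≤ _ := h1
      _ ≤ 2 * Real.pi * M * (c ^ β * (Q : ℝ) ^ (m * β)) := by gcongr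
      _ = _ := by ring
  have ht : Tendsto (fun Q : ℕ => (Q : ℝ) ^ (1 - m * β)) atTop atTop :=
    (tendsto_rpow_atTop (by linarith)).comp tendsto_natCast_atTop_atTop
  obtain ⟨Q, hQ0, hQ⟩ := ((eventually_gt_atTop 0).and
    (ht.eventually_gt_atTop (2 * Real.pi * M * c ^ β / K))).exists
  exact absurd (key Q hQ0) (not_le.2 hQ)

/-! ### Almost every frequency vector is Diophantine -/

/-- The set of `y ∈ [-N, N]` for which `k * y` is within `k ^ (-β)` of the lattice `cℤ` has measure
`O(k ^ (-β))`: it is covered by `O(k)` intervals of length `2 * k ^ (-β - 1)`. -/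
lemma exists_volume_near_lattice_le {c β : ℝ} (hc : c ≠ 0) (hβ : 0 < β) (N : ℕ) :
    ∃ C : ℝ, 0 ≤ C ∧ ∀ k : ℕ, 0 < k →
      volume {y : ℝ | |y| ≤ N ∧ ∃ l : ℤ, |k * y - l * c| < (k : ℝ) ^ (-β)}
        ≤ ENNReal.ofReal (C * (k : ℝ) ^ (-β)) := by
  have hc' : 0 < |c| := abs_pos.2 hc
  refine ⟨2 * (2 * (N + 1) / |c| + 3), by positivity, fun k hk => ?_⟩
  have hk1 : (1 : ℝ) ≤ k := by exact_mod_cast hk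
  have hk0 : (0 : ℝ) < k := by linarith
  set r := (k : ℝ) ^ (-β) with hr
  have hr0 : 0 < r := by positivity
  have hr1 : r ≤ 1 := Real.rpow_le_one_of_one_le_of_nonpos hk1 (by linarith)
  set L : ℕ := ⌈(k * N + 1) / |c|⌉₊ with hL
  have hsub : {y : ℝ | |y| ≤ N ∧ ∃ l : ℤ, |k * y - l * c| < r} ⊆
      ⋃ l ∈ Finset.Icc (-(L : ℤ)) L, Metric.ball ((l : ℝ) * c / k) (r / k) := by
    rintro y ⟨hy, l, hl⟩
    simp only [Set.mem_iUnion]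
    refine ⟨l, ?_, ?_⟩
    · have h1 : |(l : ℝ)| * |c| ≤ k * N + 1 := by
        rw [← abs_mul]
        calc |l * c| = |k * y - (k * y - l * c)| := by congr 1; ring
          _ ≤ |k * y| + |k * y - l * c| := abs_sub _ _
          _ ≤ k * N + 1 := by
            rw [abs_mul, Nat.abs_cast]
            gcongr
            linarith
      have h2 : |(l : ℝ)| ≤ L := by
        rw [← le_div_iff₀ hc'] at h1
        exact h1.trans (Nat.le_ceil _)
      have h3 : |l| ≤ L := by exact_mod_cast h2
      rw [Finset.mem_Icc]
      exact abs_le.1 h3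
    · rw [Metric.mem_ball, Real.dist_eq, lt_div_iff₀ hk0, ← abs_of_pos hk0, ← abs_mul]
      rw [abs_of_pos hk0]
      have : k * (y - l * c / k) = k * y - l * c := by field_simp
      rw [mul_comm, this]
      exact hl
  refine (measure_mono hsub).trans ((measure_biUnion_finset_le _ _).trans ?_)
  simp only [Real.volume_ball, Finset.sum_const, Int.card_Icc, nsmul_eq_mul]
  rw [← ENNReal.ofReal_natCast, ← ENNReal.ofReal_mul (by positivity)]
  apply ENNReal.ofReal_le_ofReal
  have hcard : (((L : ℤ) + 1 - -(L : ℤ)).toNat : ℝ) = 2 * L + 1 := by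
    have : ((L : ℤ) + 1 - -(L : ℤ)).toNat = 2 * L + 1 := by omega
    rw [this]; push_cast; ring
  rw [hcard]
  have hL' : (L : ℝ) ≤ (k * N + 1) / |c| + 1 := (Nat.ceil_lt_add_one (by positivity)).le
  have h4 : (k * N + 1) / |c| ≤ k * ((N + 1) / |c|) := by
    rw [← mul_div_assoc]; gcongr; nlinarith
  have h5 : 2 * (L : ℝ) + 1 ≤ (2 * (N + 1) / |c| + 3) * k := by
    have : 2 * (N + 1) / |c| * k = 2 * (k * ((N + 1) / |c|)) := by ring
    nlinarith
  calc (2 * (L : ℝ) + 1) * (2 * (r / k)) ≤ ((2 * (N + 1) / |c| + 3) * k) * (2 * (r / k)) := by gcongr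
    _ = _ := by field_simp

/-- The convergence half of Khinchin's theorem, for approximation in `m` dimensions by the
lattice `cℤ`. -/
lemma ae_eventually_not_near_lattice {m : ℕ} {c β : ℝ} (hc : c ≠ 0) (hβ0 : 0 < β)
    (hβ : 1 < m * β) :
    ∀ᵐ x : Fin m → ℝ, ∃ k₀ : ℕ, ∀ k : ℕ, k₀ ≤ k →
      ¬ ∀ j, ∃ l : ℤ, |k * x j - l * c| < (k : ℝ) ^ (-β) := by
  have hbox : ∀ N : ℕ, ∀ᵐ x : Fin m → ℝ, ∀ᶠ k : ℕ in atTop,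
      x ∉ Set.univ.pi fun _ : Fin m =>
        {y : ℝ | |y| ≤ N ∧ ∃ l : ℤ, |((k + 1 : ℕ) : ℝ) * y - l * c| < ((k + 1 : ℕ) : ℝ) ^ (-β)} := by
    intro N
    obtain ⟨C, hC, h⟩ := exists_volume_near_lattice_le hc hβ0 N
    apply ae_eventually_notMem
    have hle : ∀ k : ℕ, volume (Set.univ.pi fun _ : Fin m =>
        {y : ℝ | |y| ≤ N ∧ ∃ l : ℤ, |((k + 1 : ℕ) : ℝ) * y - l * c| < ((k + 1 : ℕ) : ℝ) ^ (-β)})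
        ≤ ENNReal.ofReal (C ^ m * ((k + 1 : ℕ) : ℝ) ^ (-(m * β))) := by
      intro k
      rw [volume_pi_pi, Finset.prod_const, Finset.card_univ, Fintype.card_fin]
      refine (pow_le_pow_left' (h (k + 1) k.succ_pos) m).trans ?_
      rw [← ENNReal.ofReal_pow (by positivity), mul_pow, ← Real.rpow_mul_natCast (by positivity)]
      refine le_of_eq ?_
      congr 3
      ring
    refine ne_top_of_le_ne_top ?_ (ENNReal.tsum_le_tsum hle)
    have hs : Summable fun k : ℕ => C ^ m * ((k + 1 : ℕ) : ℝ) ^ (-(m * β)) := by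
      refine Summable.mul_left _ ?_
      exact (summable_nat_add_iff 1).2 (Real.summable_nat_rpow.2 (by linarith))
    exact (ENNReal.ofReal_tsum_of_nonneg (fun k => by positivity) hs) ▸ ENNReal.ofReal_ne_top
  filter_upwards [ae_all_iff.2 hbox] with x hx
  obtain ⟨N, hN⟩ := exists_nat_gt (∑ j, |x j|)
  obtain ⟨k₁, hk₁⟩ := eventually_atTop.1 (hx N)
  refine ⟨k₁ + 1, fun k hk hall => ?_⟩
  obtain ⟨k, rfl⟩ : ∃ k', k = k' + 1 := ⟨k - 1, by omega⟩
  refine hk₁ k (by omega) fun j _ => ⟨?_, hall j⟩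
  exact (Finset.single_le_sum (f := fun j => |x j|) (fun _ _ => abs_nonneg _)
    (Finset.mem_univ j)).trans hN.le

/-- Small values of `latticeDist (c, x) s` produce good approximations of `k * x` by `cℤ`, with
`k` the integer nearest to `c * s / (2π)`. -/
lemma isDiophantineFreq_cons {m : ℕ} {c β : ℝ} (hc : c ≠ 0) (hβ0 : 0 < β) {x : Fin m → ℝ} {k₀ : ℕ}
    (h : ∀ k : ℕ, k₀ ≤ k → ¬ ∀ j, ∃ l : ℤ, |k * x j - l * c| < (k : ℝ) ^ (-β)) :
    IsDiophantineFreq β (Fin.cons c x : Fin (m + 1) → ℝ) := by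
  have hc' : 0 < |c| := abs_pos.2 hc
  have hpi := Real.pi_pos
  set b : Fin (m + 1) → ℝ := Fin.cons c x with hb
  set C := |c| + ∑ j, |x j| with hC
  have hC0 : 0 < C := by positivity
  set D := |c| + 1 with hD
  -- `K` is so small that a violation of the bound contradicts `h`
  set K := min 1 (1 / (C * D ^ β)) with hK
  have hK0 : 0 < K := by positivity
  suffices hlarge : ∀ s : ℝ, max 1 ((2 * Real.pi * (k₀ + 1) + 1) / |c|) < |s| →
      K / |s| ^ β ≤ latticeDist b s by
    obtain ⟨K', hK', h'⟩ := exists_le_latticeDist_of_large hK0 hlarge one_pos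
    exact ⟨K', hK', fun s hs => h' s hs.le⟩
  intro s hs
  obtain ⟨hs1, hs2⟩ := max_lt_iff.1 hs
  rw [div_lt_iff₀ hc'] at hs2
  have hs0 : 0 < |s| := by linarith
  by_contra! hlt
  set η := latticeDist b s with hη
  have hη0 : 0 ≤ η := latticeDist_nonneg _ _
  have hsβ : 1 ≤ |s| ^ β := Real.one_le_rpow hs1.le hβ0.le
  have hη1 : η ≤ 1 := by
    refine hlt.le.trans ?_
    rw [div_le_one (by positivity)]
    exact (min_le_left _ _).trans hsβ
  obtain ⟨k, hk⟩ := exists_abs_sub_le_latticeDist b s 0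
  rw [← hη, hb, Fin.cons_zero] at hk
  have e1 : 2 * Real.pi * |(k : ℝ)| = |2 * Real.pi * k| := by
    rw [abs_mul, abs_of_pos (by positivity : 0 < 2 * Real.pi)]
  have hklow : k₀ + 1 ≤ |(k : ℝ)| := by
    have h1 : |s| * |c| ≤ 2 * Real.pi * |(k : ℝ)| + η := by
      rw [e1, ← abs_mul, mul_comm s c]
      linarith [abs_sub_abs_le_abs_sub (c * s) (2 * Real.pi * k)]
    have h2 : 2 * Real.pi * (k₀ + 1) ≤ 2 * Real.pi * |(k : ℝ)| := by linarith
    exact le_of_mul_le_mul_left h2 (by positivity)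
  have hkup : |(k : ℝ)| ≤ D * |s| := by
    have h1 : 2 * Real.pi * |(k : ℝ)| ≤ |c| * |s| + η := by
      rw [e1, ← abs_mul]
      linarith [abs_sub_abs_le_abs_sub (2 * Real.pi * k) (c * s), abs_sub_comm (2 * Real.pi * k) (c * s)]
    have h3 : 1 * |(k : ℝ)| ≤ 2 * Real.pi * |(k : ℝ)| := by
      gcongr; linarith [Real.pi_gt_three]
    rw [hD]; nlinarith
  have hk0 : 0 < |(k : ℝ)| := lt_of_lt_of_le (by positivity) hklow
  have hcast : ((k.natAbs : ℕ) : ℝ) = |(k : ℝ)| := by simp [Nat.cast_natAbs]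
  refine h k.natAbs ?_ fun j => ?_
  · have : (k₀ : ℝ) ≤ (k.natAbs : ℕ) := by rw [hcast]; linarith
    exact_mod_cast this
  obtain ⟨l, hl⟩ := exists_abs_sub_le_latticeDist b s j.succ
  rw [← hη, hb, Fin.cons_succ] at hl
  -- the approximation up to sign
  have happ : |k * x j - l * c| < |(k : ℝ)| ^ (-β) := by
    have h1 : 2 * Real.pi * |k * x j - l * c| ≤ C * η := by
      rw [← abs_of_pos (by positivity : 0 < 2 * Real.pi), ← abs_mul]
      have : 2 * Real.pi * (k * x j - l * c)
          = c * (x j * s - 2 * Real.pi * l) - x j * (c * s - 2 * Real.pi * k) := by ring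
      rw [this]
      refine (abs_sub _ _).trans ?_
      rw [abs_mul, abs_mul, hC, add_mul]
      have : |x j| ≤ ∑ j, |x j| :=
        Finset.single_le_sum (f := fun j => |x j|) (fun _ _ => abs_nonneg _) (Finset.mem_univ j)
      gcongr
    have h2 : C * η < |(k : ℝ)| ^ (-β) := by
      calc C * η < C * (K / |s| ^ β) := by gcongr
        _ ≤ C * ((1 / (C * D ^ β)) / |s| ^ β) := by gcongr; exact min_le_right _ _
        _ = (D * |s|) ^ (-β) := by
          rw [Real.rpow_neg (by positivity), Real.mul_rpow (by positivity) (by positivity)]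
          field_simp
        _ ≤ |(k : ℝ)| ^ (-β) := Real.rpow_le_rpow_of_nonpos hk0 hkup (by linarith)
    have h3 : 1 * |k * x j - l * c| ≤ 2 * Real.pi * |k * x j - l * c| := by
      gcongr; linarith [Real.pi_gt_three]
    linarith
  rw [hcast]
  rcases abs_choice (k : ℝ) with hk' | hk'
  · exact ⟨l, by rw [hk'] at happ ⊢; exact happ⟩
  · refine ⟨-l, ?_⟩
    have : |(k : ℝ)| * x j - ((-l : ℤ) : ℝ) * c = -(k * x j - l * c) := by
      rw [hk']; push_cast; ring
    rw [this, abs_neg]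
    exact happ

lemma continuous_latticeDist_left {ι : Type*} [Fintype ι] (s : ℝ) :
    Continuous fun b : ι → ℝ => latticeDist b s := by
  cases isEmpty_or_nonempty ι
  · simp only [latticeDist, Real.iSup_of_isEmpty]; exact continuous_const
  · simp only [latticeDist, ← Finset.sup'_univ_eq_ciSup]
    refine Continuous.finset_sup'_apply _ fun j _ => ?_
    exact (Metric.continuous_infDist_pt _).comp (by fun_prop)

lemma measurableSet_isDiophantineFreq {ι : Type*} [Fintype ι] (β : ℝ) :
    MeasurableSet {b : ι → ℝ | IsDiophantineFreq β b} := by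
  have : {b : ι → ℝ | IsDiophantineFreq β b} = ⋃ n : ℕ,
      {b | ∀ s : ℝ, 1 < |s| → (1 / ((n : ℝ) + 1)) / |s| ^ β ≤ latticeDist b s} := by
    ext b
    simp only [Set.mem_ofPred_eq, Set.mem_iUnion]
    constructor
    · rintro ⟨K, hK, h⟩
      obtain ⟨n, hn⟩ := exists_nat_one_div_lt hK
      exact ⟨n, fun s hs => le_trans (by gcongr) (h s hs)⟩
    · rintro ⟨n, h⟩
      exact ⟨1 / ((n : ℝ) + 1), by positivity, h⟩
  rw [this]
  refine MeasurableSet.iUnion fun n => IsClosed.measurableSet ?_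
  simp only [Set.ofPred_forall]
  exact isClosed_iInter fun s => isClosed_iInter fun _ =>
    isClosed_le continuous_const (continuous_latticeDist_left s)

lemma ae_isDiophantineFreq {m : ℕ} {β : ℝ} (hβ0 : 0 < β) (hβ : 1 < m * β) :
    ∀ᵐ b : Fin (m + 1) → ℝ, IsDiophantineFreq β b := by
  have hmp := (volume_preserving_piFinSuccAbove (fun _ : Fin (m + 1) => ℝ) 0).symm
  rw [← hmp.map_eq, ae_map_iff hmp.measurable.aemeasurable (measurableSet_isDiophantineFreq β)]
  have hmeas : MeasurableSet {q : ℝ × (Fin m → ℝ) | IsDiophantineFreq β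
      ((MeasurableEquiv.piFinSuccAbove (fun _ : Fin (m + 1) => ℝ) 0).symm q)} :=
    hmp.measurable (measurableSet_isDiophantineFreq β)
  refine (Measure.ae_prod_iff_ae_ae hmeas).2 ?_
  filter_upwards [Measure.ae_ne volume (0 : ℝ)] with c hc
  filter_upwards [ae_eventually_not_near_lattice hc hβ0 hβ] with x ⟨k₀, hx⟩
  have := isDiophantineFreq_cons hc hβ0 hx
  simpa [MeasurableEquiv.piFinSuccAbove, Fin.insertNthEquiv] using this

/-- The Diophantine property depends on `a` through its differences only, so it holds almost
everywhere on every space of vectors on which the differences are independent coordinates. -/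
lemma ae_isDiophantine_of_surjective {d : ℕ} (hd : 2 ≤ d) {E : Type*} [NormedAddCommGroup E]
    [NormedSpace ℝ E] [MeasurableSpace E] [BorelSpace E] [FiniteDimensional ℝ E] (μ : Measure E)
    [μ.IsAddHaarMeasure] (T : E →ₗ[ℝ] (Fin (d + 1) → ℝ))
    (hT : ∀ b : Fin d → ℝ, ∃ x, ∀ j, T x j.succ - T x 0 = b j) :
    ∀ᵐ x ∂μ, ∀ β : ℝ, 1 / ((d : ℝ) - 1) < β → IsDiophantine β (T x) := by
  obtain ⟨m, rfl⟩ : ∃ m, d = m + 1 := ⟨d - 1, by omega⟩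
  have hm : (0 : ℝ) < m := by
    have : 0 < m := by omega
    exact_mod_cast this
  let L : E →ₗ[ℝ] (Fin (m + 1) → ℝ) :=
    LinearMap.pi fun j => LinearMap.proj j.succ ∘ₗ T - LinearMap.proj 0 ∘ₗ T
  have hL : Function.Surjective L := fun b => by
    obtain ⟨x, hx⟩ := hT b
    exact ⟨x, funext fun j => by simpa [L] using hx j⟩
  have h : ∀ᵐ x ∂μ, ∀ n : ℕ, IsDiophantineFreq (1 / (m : ℝ) + 1 / ((n : ℝ) + 1)) (L x) := by
    refine ae_all_iff.2 fun n => ?_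
    refine (ae_comp_linearMap_mem_iff L μ volume hL (measurableSet_isDiophantineFreq _)).2 ?_
    refine ae_isDiophantineFreq (by positivity) ?_
    rw [mul_add, mul_one_div_cancel hm.ne']
    have : 0 < (m : ℝ) * (1 / ((n : ℝ) + 1)) := by positivity
    linarith
  filter_upwards [h] with x hx β hβ
  obtain ⟨n, hn⟩ := exists_nat_one_div_lt (sub_pos.2 hβ)
  refine (hx n).mono ?_
  push_cast at hn ⊢
  rw [add_sub_cancel_right] at hn
  linarith

/-! ### Fourier transforms of polynomials times the Gaussian density -/

lemma exists_norm_aeval_le (P : Polynomial ℝ) :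
    ∃ C : ℝ, 0 < C ∧ ∀ y : ℂ, ‖Polynomial.aeval y P‖ ≤ C * Real.exp (‖y‖ ^ 2 / 8) := by
  refine ⟨(1 + ∑ i ∈ Finset.range (P.natDegree + 1), |P.coeff i| * i.factorial) * Real.exp 2,
    by positivity, fun y => ?_⟩
  rw [Polynomial.aeval_eq_sum_range, mul_assoc, ← Real.exp_add]
  have h1 : Real.exp ‖y‖ ≤ Real.exp (2 + ‖y‖ ^ 2 / 8) :=
    Real.exp_le_exp.2 (by nlinarith [sq_nonneg (‖y‖ - 4)])
  refine (norm_sum_le _ _).trans ?_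
  calc ∑ i ∈ Finset.range (P.natDegree + 1), ‖P.coeff i • y ^ i‖
      ≤ ∑ i ∈ Finset.range (P.natDegree + 1), |P.coeff i| * i.factorial * Real.exp ‖y‖ := by
        refine Finset.sum_le_sum fun i _ => ?_
        rw [norm_smul, norm_pow, Real.norm_eq_abs, mul_assoc]
        gcongr
        have := Real.pow_div_factorial_le_exp ‖y‖ (norm_nonneg y) i
        rwa [div_le_iff₀' (by positivity)] at this
    _ = (∑ i ∈ Finset.range (P.natDegree + 1), |P.coeff i| * i.factorial) * Real.exp ‖y‖ := by
        rw [Finset.sum_mul]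
    _ ≤ _ := by
        gcongr
        linarith

lemma exists_abs_eval_le (P : Polynomial ℝ) :
    ∃ C : ℝ, 0 < C ∧ ∀ z : ℝ, |P.eval z| ≤ C * Real.exp (z ^ 2 / 8) := by
  obtain ⟨C, hC, h⟩ := exists_norm_aeval_le P
  refine ⟨C, hC, fun z => ?_⟩
  have := h (z : ℂ)
  rwa [← Complex.coe_algebraMap, Polynomial.aeval_algebraMap_apply, Complex.coe_algebraMap,
    Polynomial.coe_aeval_eq_eval, Complex.norm_real, Complex.norm_real, Real.norm_eq_abs,
    Real.norm_eq_abs, sq_abs] at this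

lemma gaussianPDFReal_zero_one (z : ℝ) :
    gaussianPDFReal 0 1 z = (√(2 * Real.pi))⁻¹ * Real.exp (-z ^ 2 / 2) := by
  simp [gaussianPDFReal]

lemma gaussianPDFReal_zero_one_le (z : ℝ) : gaussianPDFReal 0 1 z ≤ Real.exp (-z ^ 2 / 2) := by
  rw [gaussianPDFReal_zero_one]
  refine mul_le_of_le_one_left (by positivity) (inv_le_one_of_one_le₀ ?_)
  rw [Real.one_le_sqrt]
  linarith [Real.pi_gt_three]

lemma continuous_gaussianPDFReal_zero_one : Continuous (gaussianPDFReal 0 1) := by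
  simp only [funext gaussianPDFReal_zero_one]
  fun_prop

lemma hasDerivAt_gaussianPDFReal (z : ℝ) :
    HasDerivAt (gaussianPDFReal 0 1) (-(z * gaussianPDFReal 0 1 z)) z := by
  have h : HasDerivAt (fun z : ℝ => (√(2 * Real.pi))⁻¹ * Real.exp (-z ^ 2 / 2))
      ((√(2 * Real.pi))⁻¹ * (Real.exp (-z ^ 2 / 2) * (-(2 * z) / 2))) z := by
    have h1 := ((((hasDerivAt_id z).pow 2).neg.div_const 2).exp).const_mul (√(2 * Real.pi))⁻¹
    simpa using h1
  rw [← funext gaussianPDFReal_zero_one] at h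
  convert h using 1
  rw [gaussianPDFReal_zero_one]; ring

/-- A polynomial times the Gaussian density. -/
def gaussMul (P : Polynomial ℝ) (z : ℝ) : ℝ := gaussianPDFReal 0 1 z * P.eval z

lemma exists_abs_gaussMul_le (P : Polynomial ℝ) :
    ∃ C : ℝ, 0 < C ∧ ∀ z : ℝ, |gaussMul P z| ≤ C * Real.exp (-(1 / 4) * z ^ 2) := by
  obtain ⟨C, hC, h⟩ := exists_abs_eval_le P
  refine ⟨C, hC, fun z => ?_⟩
  rw [gaussMul, abs_mul, abs_of_nonneg (gaussianPDFReal_nonneg _ _ _)]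
  calc gaussianPDFReal 0 1 z * |P.eval z|
      ≤ Real.exp (-z ^ 2 / 2) * (C * Real.exp (z ^ 2 / 8)) := by
        gcongr
        · exact gaussianPDFReal_zero_one_le z
        · exact h z
    _ = C * Real.exp (-z ^ 2 / 2 + z ^ 2 / 8) := by rw [Real.exp_add]; ring
    _ ≤ _ := by
        gcongr
        nlinarith [sq_nonneg z]

lemma continuous_gaussMul (P : Polynomial ℝ) : Continuous (gaussMul P) :=
  continuous_gaussianPDFReal_zero_one.mul P.continuous

lemma integrable_gaussMul (P : Polynomial ℝ) : Integrable (gaussMul P) := by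
  obtain ⟨C, hC, h⟩ := exists_abs_gaussMul_le P
  refine Integrable.mono' ((integrable_exp_neg_mul_sq (b := 1 / 4) (by norm_num)).const_mul C)
    (continuous_gaussMul P).aestronglyMeasurable (ae_of_all _ fun z => ?_)
  exact h z

lemma tendsto_gaussMul_cocompact (P : Polynomial ℝ) :
    Tendsto (gaussMul P) (cocompact ℝ) (𝓝 0) := by
  obtain ⟨C, hC, h⟩ := exists_abs_gaussMul_le P
  refine squeeze_zero_norm h ?_
  rw [← mul_zero C]
  refine Tendsto.const_mul C (Real.tendsto_exp_atBot.comp ?_)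
  have h1 : Tendsto (fun z : ℝ => ‖z‖ ^ 2) (cocompact ℝ) atTop :=
    (tendsto_pow_atTop two_ne_zero).comp tendsto_norm_cocompact_atTop
  simp only [Real.norm_eq_abs, sq_abs] at h1
  exact h1.const_mul_atTop_of_neg (by norm_num)

/-- The operator `P ↦ X P - P'`, which satisfies `(𝔫 P)' = -𝔫 (X P - P')` for the Gaussian
density `𝔫`; its iterates on `1` are the Hermite polynomials. -/
def hermiteOp : Module.End ℝ (Polynomial ℝ) :=
  LinearMap.mulLeft ℝ Polynomial.X - Polynomial.derivative

lemma hermiteOp_apply (P : Polynomial ℝ) :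
    hermiteOp P = Polynomial.X * P - Polynomial.derivative P := rfl

lemma hasDerivAt_gaussMul (P : Polynomial ℝ) (z : ℝ) :
    HasDerivAt (gaussMul P) (-gaussMul (hermiteOp P) z) z := by
  have := (hasDerivAt_gaussianPDFReal z).mul (P.hasDerivAt z)
  refine this.congr_deriv ?_
  simp only [gaussMul, hermiteOp_apply, Polynomial.eval_sub, Polynomial.eval_mul,
    Polynomial.eval_X]
  ring

/-- The Fourier transform of a polynomial times the Gaussian density. -/
def gaussTransform (P : Polynomial ℝ) (t : ℝ) : ℂ :=
  ∫ z : ℝ, Complex.exp ((t : ℂ) * (z : ℂ) * Complex.I) * (gaussMul P z : ℂ)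

lemma norm_exp_mul_I (t z : ℝ) : ‖Complex.exp ((t : ℂ) * (z : ℂ) * Complex.I)‖ = 1 := by
  rw [← Complex.ofReal_mul, Complex.norm_exp_ofReal_mul_I]

lemma integrable_exp_mul_I_mul {g : ℝ → ℝ} (hg : Integrable g) (t : ℝ) :
    Integrable fun z : ℝ => Complex.exp ((t : ℂ) * (z : ℂ) * Complex.I) * (g z : ℂ) := by
  refine hg.ofReal.bdd_mul (c := 1) (by fun_prop) (ae_of_all _ fun z => ?_)
  rw [norm_exp_mul_I]

lemma gaussTransform_add (P Q : Polynomial ℝ) (t : ℝ) :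
    gaussTransform (P + Q) t = gaussTransform P t + gaussTransform Q t := by
  rw [gaussTransform, gaussTransform, gaussTransform, ← integral_add
    (integrable_exp_mul_I_mul (integrable_gaussMul P) t)
    (integrable_exp_mul_I_mul (integrable_gaussMul Q) t)]
  congr 1; ext z
  simp only [gaussMul, Polynomial.eval_add]
  push_cast; ring

lemma gaussTransform_smul (c : ℝ) (P : Polynomial ℝ) (t : ℝ) :
    gaussTransform (c • P) t = c * gaussTransform P t := by
  rw [gaussTransform, gaussTransform, ← integral_const_mul]
  congr 1; ext z
  simp only [gaussMul, Polynomial.eval_smul, smul_eq_mul]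
  push_cast; ring

/-- `gaussTransform` as a linear map. -/
def gaussTransformₗ (t : ℝ) : Polynomial ℝ →ₗ[ℝ] ℂ where
  toFun P := gaussTransform P t
  map_add' P Q := gaussTransform_add P Q t
  map_smul' c P := by simp [gaussTransform_smul]

lemma gaussTransform_one (t : ℝ) : gaussTransform 1 t = Complex.exp (-(t : ℂ) ^ 2 / 2) := by
  have h := charFun_gaussianReal (μ := 0) (v := 1) t
  rw [charFun_apply_real, integral_gaussianReal_eq_integral_smul one_ne_zero] at h
  rw [gaussTransform]
  convert h using 1
  · congr 1; ext z
    simp [gaussMul, mul_comm]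
  · simp; ring_nf

lemma gaussTransform_hermiteOp (P : Polynomial ℝ) (t : ℝ) :
    gaussTransform (hermiteOp P) t = t * Complex.I * gaussTransform P t := by
  have hu (z : ℝ) : HasDerivAt (fun z : ℝ => Complex.exp ((t : ℂ) * (z : ℂ) * Complex.I))
      (t * Complex.I * Complex.exp ((t : ℂ) * (z : ℂ) * Complex.I)) z := by
    have := (((hasDerivAt_id z).ofReal_comp.const_mul (t : ℂ)).mul_const Complex.I).cexp
    refine this.congr_deriv ?_
    simp; ring
  have hv (z : ℝ) : HasDerivAt (fun z : ℝ => (gaussMul P z : ℂ))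
      (-(gaussMul (hermiteOp P) z : ℂ)) z := by
    simpa using (hasDerivAt_gaussMul P z).ofReal_comp
  have h := integral_mul_deriv_eq_deriv_mul_of_integrable (fun z _ => hu z) (fun z _ => hv z) ?_ ?_ ?_
  · simp only [mul_neg, integral_neg, neg_inj, mul_assoc, integral_const_mul] at h
    rw [gaussTransform, gaussTransform]
    simp only [mul_assoc]
    exact h
  · have := (integrable_exp_mul_I_mul (integrable_gaussMul (hermiteOp P)) t).neg
    refine this.congr (ae_of_all _ fun z => ?_)
    simp
  · have := (integrable_exp_mul_I_mul (integrable_gaussMul P) t).const_mul (t * Complex.I)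
    refine this.congr (ae_of_all _ fun z => ?_)
    simp [mul_assoc]
  · exact integrable_exp_mul_I_mul (integrable_gaussMul P) t

/-- The linear map sending `X ^ j` to the `j`-th Hermite polynomial. -/
def hermiteExpansion (A : Polynomial ℝ) : Polynomial ℝ := Polynomial.aeval hermiteOp A 1

lemma hermiteExpansion_X_mul (A : Polynomial ℝ) :
    hermiteExpansion (Polynomial.X * A) = hermiteOp (hermiteExpansion A) := by
  simp [hermiteExpansion]

lemma hermiteExpansion_add (A B : Polynomial ℝ) :
    hermiteExpansion (A + B) = hermiteExpansion A + hermiteExpansion B := by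
  simp [hermiteExpansion]

lemma hermiteExpansion_smul (c : ℝ) (A : Polynomial ℝ) :
    hermiteExpansion (c • A) = c • hermiteExpansion A := by
  simp [hermiteExpansion]

lemma hermiteExpansion_one : hermiteExpansion 1 = 1 := by
  simp [hermiteExpansion]

lemma gaussTransform_hermiteExpansion (A : Polynomial ℝ) (t : ℝ) :
    gaussTransform (hermiteExpansion A) t =
      Complex.exp (-(t : ℂ) ^ 2 / 2) * Polynomial.aeval (t * Complex.I) A := by
  induction A using Polynomial.induction_on' with
  | add p q hp hq => rw [hermiteExpansion_add, gaussTransform_add, hp, hq, map_add, mul_add]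
  | monomial n a =>
    rw [← Polynomial.C_mul_X_pow_eq_monomial, ← Polynomial.smul_eq_C_mul, hermiteExpansion_smul,
      gaussTransform_smul, map_smul, Complex.real_smul, mul_left_comm]
    congr 1
    induction n with
    | zero => simp [hermiteExpansion_one, gaussTransform_one]
    | succ n ih =>
      rw [pow_succ', hermiteExpansion_X_mul, gaussTransform_hermiteOp, ih, map_mul,
        Polynomial.aeval_X]
      ring

/-- Hermite polynomials span: `X ^ (n + 1) = L (X ^ n) + n X ^ (n - 1)` for `L = hermiteOp`. -/
lemma hermiteExpansion_surjective : Function.Surjective hermiteExpansion := by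
  have hpow : ∀ n : ℕ, ∃ A, hermiteExpansion A = Polynomial.X ^ n := by
    intro n
    induction n using Nat.strong_induction_on with
    | _ n ih =>
      obtain _ | n := n
      · exact ⟨1, by simp [hermiteExpansion_one]⟩
      obtain ⟨A, hA⟩ := ih n (by omega)
      obtain ⟨B, hB⟩ : ∃ B, hermiteExpansion B = Polynomial.derivative (Polynomial.X ^ n) := by
        obtain _ | n := n
        · exact ⟨0, by simp [hermiteExpansion]⟩
        obtain ⟨B, hB⟩ := ih n (by omega)
        refine ⟨((n : ℝ) + 1) • B, ?_⟩
        rw [hermiteExpansion_smul, hB, Polynomial.smul_eq_C_mul]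
        simp
      refine ⟨Polynomial.X * A + B, ?_⟩
      rw [hermiteExpansion_add, hermiteExpansion_X_mul, hA, hB, hermiteOp_apply]
      ring
  intro P
  induction P using Polynomial.induction_on' with
  | add p q hp hq =>
    obtain ⟨A, rfl⟩ := hp
    obtain ⟨B, rfl⟩ := hq
    exact ⟨A + B, hermiteExpansion_add A B⟩
  | monomial n a =>
    obtain ⟨A, hA⟩ := hpow n
    refine ⟨a • A, ?_⟩
    rw [hermiteExpansion_smul, hA, ← Polynomial.C_mul_X_pow_eq_monomial, Polynomial.smul_eq_C_mul]

lemma eq_zero_of_gaussTransform_eq_zero {P : Polynomial ℝ}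
    (h : ∀ t : ℝ, t ≠ 0 → gaussTransform P t = 0) : P = 0 := by
  obtain ⟨A, rfl⟩ := hermiteExpansion_surjective P
  suffices A = 0 by subst this; simp [hermiteExpansion]
  have hmap : A.map (algebraMap ℝ ℂ) = 0 := by
    refine Polynomial.eq_zero_of_infinite_isRoot _ ?_
    refine Set.Infinite.mono (s := (fun t : ℝ => (t : ℂ) * Complex.I) '' {0}ᶜ) ?_ ?_
    · rintro _ ⟨t, ht, rfl⟩
      have h1 := h t ht
      rw [gaussTransform_hermiteExpansion] at h1
      have h2 := (mul_eq_zero.1 h1).resolve_left (Complex.exp_ne_zero _)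
      rwa [← Polynomial.eval_map_algebraMap] at h2
    · refine Set.Infinite.image ?_ (Set.finite_singleton (0 : ℝ)).infinite_compl
      intro x _ y _ hxy
      simpa using hxy
  exact (Polynomial.map_eq_zero _).1 hmap

/-! ### Edgeworth expressions and their Fourier transforms -/

lemma hasDerivAt_normalCDF (z : ℝ) : HasDerivAt normalCDF (gaussianPDFReal 0 1 z) z := by
  have hint := integrable_gaussianPDFReal 0 1
  have h1 : normalCDF = fun z => normalCDF 0 + ∫ y in (0 : ℝ)..z, gaussianPDFReal 0 1 y := by
    ext z
    rw [← intervalIntegral.integral_Iic_sub_Iic hint.integrableOn hint.integrableOn]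
    simp [normalCDF]
  rw [h1]
  exact (intervalIntegral.integral_hasDerivAt_right hint.intervalIntegrable
    (stronglyMeasurable_gaussianPDFReal 0 1).stronglyMeasurableAtFilter
    continuous_gaussianPDFReal_zero_one.continuousAt).const_add _

/-- The polynomial `Q` for which the Edgeworth expression has derivative `𝔫 Q`, where `𝔫` is the
Gaussian density. -/
def edgeworthFactor {r : ℕ} (P : Fin r → Polynomial ℝ) (n : ℕ) : Polynomial ℝ :=
  1 - ∑ k : Fin r, ((n : ℝ) ^ ((((k : ℕ) : ℝ) + 1) / 2))⁻¹ • hermiteOp (P k)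

lemma gaussMul_edgeworthFactor {r : ℕ} (P : Fin r → Polynomial ℝ) (n : ℕ) (z : ℝ) :
    gaussMul (edgeworthFactor P n) z = gaussianPDFReal 0 1 z -
      ∑ k : Fin r, ((n : ℝ) ^ ((((k : ℕ) : ℝ) + 1) / 2))⁻¹ * gaussMul (hermiteOp (P k)) z := by
  simp only [gaussMul, edgeworthFactor, Polynomial.eval_sub, Polynomial.eval_finsetSum,
    Polynomial.eval_smul, smul_eq_mul, mul_sub, Finset.mul_sum, Polynomial.eval_one, mul_one]
  congr 1
  exact Finset.sum_congr rfl fun k _ => by ring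

lemma hasDerivAt_edgeworthExpr {r : ℕ} (P : Fin r → Polynomial ℝ) (n : ℕ) (z : ℝ) :
    HasDerivAt (edgeworthExpr P n) (gaussMul (edgeworthFactor P n) z) z := by
  have h1 : edgeworthExpr P n = fun z => normalCDF z +
      ∑ k : Fin r, ((n : ℝ) ^ ((((k : ℕ) : ℝ) + 1) / 2))⁻¹ * gaussMul (P k) z := by
    ext z
    rw [edgeworthExpr, Finset.mul_sum]
    congr 1
    refine Finset.sum_congr rfl fun k _ => ?_
    rw [gaussMul]; ring
  rw [h1]
  refine ((hasDerivAt_normalCDF z).add (HasDerivAt.fun_sum fun k _ =>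
    (hasDerivAt_gaussMul (P k) z).const_mul _)).congr_deriv ?_
  rw [gaussMul_edgeworthFactor, sub_eq_add_neg, ← Finset.sum_neg_distrib]
  simp only [mul_neg]

lemma edgeworthFourier_eq_gaussTransform {r : ℕ} (P : Fin r → Polynomial ℝ) (n : ℕ) (t : ℝ) :
    edgeworthFourier P n t = gaussTransform (edgeworthFactor P n) t := by
  simp only [edgeworthFourier, gaussTransform, (hasDerivAt_edgeworthExpr P n _).deriv]

lemma edgeworthFourier_eq {r : ℕ} (P : Fin r → Polynomial ℝ) (n : ℕ) (t : ℝ) :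
    edgeworthFourier P n t = Complex.exp (-(t : ℂ) ^ 2 / 2) -
      ∑ k : Fin r, (((n : ℝ) ^ ((((k : ℕ) : ℝ) + 1) / 2))⁻¹ : ℝ) *
        (t * Complex.I * gaussTransform (P k) t) := by
  rw [edgeworthFourier_eq_gaussTransform, edgeworthFactor]
  change gaussTransformₗ t _ = _
  rw [map_sub, map_sum]
  simp only [map_smul]
  simp only [gaussTransformₗ, LinearMap.coe_mk, AddHom.coe_mk, gaussTransform_one,
    gaussTransform_hermiteOp, Complex.real_smul]

lemma tendsto_setIntegral_Iic_atBot {μ : Measure ℝ} {f : ℝ → ℝ} (hf : Integrable f μ) :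
    Tendsto (fun z => ∫ x in Set.Iic z, f x ∂μ) atBot (𝓝 0) := by
  have := tendsto_setIntegral_of_antitone (μ := μ) (f := f)
    (s := fun z : ℝᵒᵈ => Set.Iic (OrderDual.ofDual z)) (fun _ => measurableSet_Iic)
    (fun a b hab => Set.Iic_subset_Iic.2 hab) ⟨OrderDual.toDual 0, hf.integrableOn⟩
  have he : (⋂ z : ℝᵒᵈ, Set.Iic (OrderDual.ofDual z)) = (∅ : Set ℝ) := by
    refine Set.eq_empty_of_forall_notMem fun x hx => ?_
    have := Set.mem_iInter.1 hx (OrderDual.toDual (x - 1))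
    simp at this
    linarith
  rw [he, setIntegral_empty] at this
  exact this

/-- The Edgeworth expression is the distribution function of the signed density
`gaussMul (edgeworthFactor P n)`. -/
lemma edgeworthExpr_eq_integral {r : ℕ} (P : Fin r → Polynomial ℝ) (n : ℕ) (z : ℝ) :
    edgeworthExpr P n z = ∫ y in Set.Iic z, gaussMul (edgeworthFactor P n) y := by
  have hbot : Tendsto (edgeworthExpr P n) atBot (𝓝 0) := by
    have h1 : Tendsto normalCDF atBot (𝓝 0) :=
      tendsto_setIntegral_Iic_atBot (integrable_gaussianPDFReal 0 1)
    have h2 : Tendsto (fun z => ∑ k : Fin r, ((n : ℝ) ^ ((((k : ℕ) : ℝ) + 1) / 2))⁻¹ *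
        gaussMul (P k) z) atBot (𝓝 (∑ k : Fin r, ((n : ℝ) ^ ((((k : ℕ) : ℝ) + 1) / 2))⁻¹ * 0)) :=
      tendsto_finsetSum _ fun k _ => ((tendsto_gaussMul_cocompact (P k)).mono_left
        atBot_le_cocompact).const_mul _
    have h3 := h1.add h2
    simp only [mul_zero, Finset.sum_const_zero, add_zero] at h3
    refine h3.congr fun z => ?_
    rw [edgeworthExpr, Finset.mul_sum]
    congr 1
    refine Finset.sum_congr rfl fun k _ => ?_
    rw [gaussMul]; ring
  rw [integral_Iic_of_hasDerivAt_of_tendsto' (fun x _ => hasDerivAt_edgeworthExpr P n x)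
    (integrable_gaussMul _).integrableOn hbot, sub_zero]

/-- Uniform Gaussian domination of the densities `gaussMul (edgeworthFactor P n)`. -/
lemma exists_abs_edgeworthDensity_le {r : ℕ} (P : Fin r → Polynomial ℝ) :
    ∃ B : ℝ, 0 < B ∧ ∀ n : ℕ, 0 < n → ∀ z,
      |gaussMul (edgeworthFactor P n) z| ≤ B * Real.exp (-(1 / 4) * z ^ 2) := by
  choose C hC h using fun k => exists_abs_gaussMul_le (hermiteOp (P k))
  obtain ⟨C₀, hC₀, h₀⟩ := exists_abs_gaussMul_le 1
  refine ⟨C₀ + ∑ k, C k, by have := Finset.sum_nonneg fun k (_ : k ∈ Finset.univ) => (hC k).le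
                            positivity, fun n hn z => ?_⟩
  rw [gaussMul_edgeworthFactor, add_mul, Finset.sum_mul]
  refine (abs_sub _ _).trans (add_le_add ?_ ((Finset.abs_sum_le_sum_abs _ _).trans
    (Finset.sum_le_sum fun k _ => ?_)))
  · simpa [gaussMul] using h₀ z
  rw [abs_mul]
  have hn1 : (1 : ℝ) ≤ (n : ℝ) ^ ((((k : ℕ) : ℝ) + 1) / 2) :=
    Real.one_le_rpow (by exact_mod_cast hn) (by positivity)
  rw [abs_of_nonneg (by positivity)]
  exact (mul_le_of_le_one_left (abs_nonneg _) (inv_le_one_of_one_le₀ hn1)).trans (h k z)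

/-- Uniform Gaussian domination of the Fourier transforms of the Edgeworth expressions. -/
lemma exists_norm_edgeworthFourier_le {r : ℕ} (P : Fin r → Polynomial ℝ) :
    ∃ B : ℝ, 0 < B ∧ ∀ n : ℕ, 0 < n → ∀ t : ℝ,
      ‖edgeworthFourier P n t‖ ≤ B * Real.exp (-(1 / 4) * t ^ 2) := by
  have hT : ∀ Q : Polynomial ℝ, ∃ B : ℝ, 0 < B ∧ ∀ t : ℝ,
      ‖gaussTransform Q t‖ ≤ B * Real.exp (-(1 / 4) * t ^ 2) := by
    intro Q
    obtain ⟨A, rfl⟩ := hermiteExpansion_surjective Q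
    obtain ⟨C, hC, h⟩ := exists_norm_aeval_le A
    refine ⟨C, hC, fun t => ?_⟩
    rw [gaussTransform_hermiteExpansion, norm_mul]
    have h1 := h (t * Complex.I)
    rw [norm_mul, Complex.norm_I, mul_one, Complex.norm_real, Real.norm_eq_abs, sq_abs] at h1
    have h2 : ‖Complex.exp (-(t : ℂ) ^ 2 / 2)‖ = Real.exp (-t ^ 2 / 2) := by
      rw [Complex.norm_exp]; norm_cast
    rw [h2]
    calc Real.exp (-t ^ 2 / 2) * ‖Polynomial.aeval (t * Complex.I) A‖
        ≤ Real.exp (-t ^ 2 / 2) * (C * Real.exp (t ^ 2 / 8)) := by gcongr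
      _ = C * Real.exp (-t ^ 2 / 2 + t ^ 2 / 8) := by rw [Real.exp_add]; ring
      _ ≤ _ := by gcongr; nlinarith [sq_nonneg t]
  choose C hC h using fun k => hT (hermiteOp (P k))
  obtain ⟨C₀, hC₀, h₀⟩ := hT 1
  refine ⟨C₀ + ∑ k, C k, by have := Finset.sum_nonneg fun k (_ : k ∈ Finset.univ) => (hC k).le
                            positivity, fun n hn t => ?_⟩
  rw [edgeworthFourier_eq, ← gaussTransform_one]
  simp only [← gaussTransform_hermiteOp]
  rw [add_mul, Finset.sum_mul]
  refine (norm_sub_le _ _).trans (add_le_add (h₀ t) ((norm_sum_le _ _).trans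
    (Finset.sum_le_sum fun k _ => ?_)))
  rw [norm_mul, Complex.norm_real, Real.norm_eq_abs]
  have hn1 : (1 : ℝ) ≤ (n : ℝ) ^ ((((k : ℕ) : ℝ) + 1) / 2) :=
    Real.one_le_rpow (by exact_mod_cast hn) (by positivity)
  rw [abs_of_nonneg (by positivity)]
  exact (mul_le_of_le_one_left (norm_nonneg _) (inv_le_one_of_one_le₀ hn1)).trans (h k t)

/-- An expansion in powers of `n ^ (-1/2)` up to order `r` that is `o(n ^ (-r/2))` vanishes. -/
lemma eq_zero_of_isLittleO {r : ℕ} (c : Fin r → ℂ)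
    (h : (fun n : ℕ => ∑ k : Fin r, (((n : ℝ) ^ ((((k : ℕ) : ℝ) + 1) / 2))⁻¹ : ℝ) * c k)
      =o[atTop] (fun n : ℕ => (n : ℝ) ^ (-((r : ℝ) / 2)))) (k : Fin r) : c k = 0 := by
  obtain ⟨k, hk⟩ := k
  induction k using Nat.strong_induction_on with
  | _ k ih =>
    have hpow (x y : ℝ) {n : ℕ} (hn : 0 < n) : (n : ℝ) ^ x * ((n : ℝ) ^ y)⁻¹ = (n : ℝ) ^ (x - y) := by
      rw [Real.rpow_sub (by exact_mod_cast hn), div_eq_mul_inv]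
    -- multiplied by `n ^ ((k + 1) / 2)`, the sum tends to `c k` and to `0`
    have h1 : Tendsto (fun n : ℕ => (((n : ℝ) ^ (((k : ℝ) + 1) / 2) : ℝ) : ℂ) *
        ∑ k : Fin r, (((n : ℝ) ^ ((((k : ℕ) : ℝ) + 1) / 2))⁻¹ : ℝ) * c k) atTop (𝓝 0) := by
      have h2 : (fun n : ℕ => (((n : ℝ) ^ (((k : ℝ) + 1) / 2) : ℝ) : ℂ) *
          ∑ k : Fin r, (((n : ℝ) ^ ((((k : ℕ) : ℝ) + 1) / 2))⁻¹ : ℝ) * c k) =o[atTop]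
          (fun n : ℕ => (n : ℝ) ^ (((k : ℝ) + 1) / 2) * (n : ℝ) ^ (-((r : ℝ) / 2))) := by
        refine IsBigO.mul_isLittleO ?_ h
        exact isBigO_of_le _ fun n => by simp
      refine (isLittleO_one_iff ℝ).1 (h2.trans_isBigO ?_)
      refine IsBigO.of_bound 1 ?_
      filter_upwards [eventually_gt_atTop 0] with n hn
      have hn' : (0 : ℝ) < n := by exact_mod_cast hn
      rw [← Real.rpow_add hn', norm_one, mul_one, Real.norm_of_nonneg (by positivity)]
      refine Real.rpow_le_one_of_one_le_of_nonpos (by exact_mod_cast hn) ?_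
      have : (k : ℝ) + 1 ≤ r := by exact_mod_cast hk
      linarith
    have h3 : Tendsto (fun n : ℕ => (((n : ℝ) ^ (((k : ℝ) + 1) / 2) : ℝ) : ℂ) *
        ∑ k : Fin r, (((n : ℝ) ^ ((((k : ℕ) : ℝ) + 1) / 2))⁻¹ : ℝ) * c k) atTop
        (𝓝 (∑ j : Fin r, if j = ⟨k, hk⟩ then c j else 0)) := by
      simp only [Finset.mul_sum]
      refine tendsto_finsetSum _ fun j _ => ?_
      rcases lt_trichotomy (j : ℕ) k with hj | hj | hj
      · rw [if_neg (fun e => by simp [e] at hj), ih j hj j.2]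
        simp
      · have hj' : j = ⟨k, hk⟩ := Fin.ext hj
        rw [if_pos hj']
        refine tendsto_const_nhds.congr' ?_
        filter_upwards [eventually_gt_atTop 0] with n hn
        rw [← mul_assoc, ← Complex.ofReal_mul, hpow _ _ hn, hj, sub_self, Real.rpow_zero]
        simp
      · rw [if_neg (fun e => by simp [e] at hj)]
        have h4 : Tendsto (fun n : ℕ => (((n : ℝ) ^ (-(((j : ℝ) - k) / 2)) : ℝ) : ℂ) * c j) atTop
            (𝓝 (((0 : ℝ) : ℂ) * c j)) := by
          refine Tendsto.mul_const _ ((Complex.continuous_ofReal.tendsto 0).comp ?_)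
          refine (tendsto_rpow_neg_atTop ?_).comp tendsto_natCast_atTop_atTop
          have : (k : ℝ) < (j : ℕ) := by exact_mod_cast hj
          linarith
        rw [Complex.ofReal_zero, zero_mul] at h4
        refine h4.congr' ?_
        filter_upwards [eventually_gt_atTop 0] with n hn
        rw [← mul_assoc, ← Complex.ofReal_mul, hpow _ _ hn]
        ring_nf
    simpa using tendsto_nhds_unique h3 h1

theorem IsEdgeworthSeries.unique {μ : Measure ℝ} {r : ℕ} {P Q : Fin r → Polynomial ℝ}
    (hP : IsEdgeworthSeries μ P) (hQ : IsEdgeworthSeries μ Q) : P = Q := by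
  ext1 k
  rw [← sub_eq_zero]
  refine eq_zero_of_gaussTransform_eq_zero fun t ht => ?_
  have h := (hP t).sub (hQ t)
  have h2 := eq_zero_of_isLittleO (fun k => t * Complex.I * gaussTransform (P k - Q k) t)
    (h.congr_left fun n => ?_) k
  · exact (mul_eq_zero.1 h2).resolve_left (by simp [ht])
  · rw [edgeworthFourier_eq, edgeworthFourier_eq, sub_sub_sub_cancel_left, sub_sub_sub_cancel_left,
      ← Finset.sum_sub_distrib]
    refine Finset.sum_congr rfl fun k _ => ?_
    have : gaussTransform (P k - Q k) t = gaussTransform (P k) t - gaussTransform (Q k) t :=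
      map_sub (gaussTransformₗ t) _ _
    rw [this]; ring

/-! ### Real Taylor polynomials of analytic functions that are real on the real line -/

lemma AnalyticAt.dslope {f : ℂ → ℂ} (hf : AnalyticAt ℂ f 0) : AnalyticAt ℂ (dslope f 0) 0 := by
  obtain ⟨p, hp⟩ := hf
  exact ⟨_, hp.has_fpower_series_dslope_fslope⟩

lemma AnalyticAt.tendsto_ofReal {f : ℂ → ℂ} (hf : AnalyticAt ℂ f 0) :
    Tendsto (fun x : ℝ => f x) (𝓝[≠] 0) (𝓝 (f 0)) := by
  have h : Tendsto (fun x : ℝ => (x : ℂ)) (𝓝[≠] 0) (𝓝 0) := by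
    have := Complex.continuous_ofReal.tendsto 0
    rw [Complex.ofReal_zero] at this
    exact this.mono_left nhdsWithin_le_nhds
  exact hf.continuousAt.tendsto.comp h

lemma im_eq_zero_of_eventually {f : ℂ → ℂ} (hf : AnalyticAt ℂ f 0)
    (hreal : ∀ᶠ x : ℝ in 𝓝[≠] 0, (f x).im = 0) : (f 0).im = 0 :=
  tendsto_nhds_unique ((Complex.continuous_im.tendsto _).comp hf.tendsto_ofReal)
    (tendsto_const_nhds.congr' (hreal.mono fun _ h => h.symm))

lemma eventually_dslope_im_eq_zero {f : ℂ → ℂ} (hf : AnalyticAt ℂ f 0)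
    (hreal : ∀ᶠ x : ℝ in 𝓝[≠] 0, (f x).im = 0) :
    ∀ᶠ x : ℝ in 𝓝[≠] 0, (dslope f 0 x).im = 0 := by
  filter_upwards [hreal, self_mem_nhdsWithin] with x hx hx0
  rw [dslope_of_ne _ (by simpa using hx0), slope_def_field, sub_zero, Complex.div_ofReal_im]
  simp [hx, im_eq_zero_of_eventually hf hreal]

lemma apply_eq_add_mul_dslope (f : ℂ → ℂ) (y : ℂ) : f y = f 0 + y * dslope f 0 y := by
  have := sub_smul_dslope f 0 y
  rw [smul_eq_mul, sub_zero] at this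
  rw [this]; ring

/-- Taylor's formula with real coefficients for a function vanishing to order `j` at `0`. -/
lemma exists_real_taylor (m j : ℕ) {f : ℂ → ℂ} (hf : AnalyticAt ℂ f 0)
    (hreal : ∀ᶠ x : ℝ in 𝓝[≠] 0, (f x).im = 0) (hj : f =O[𝓝[≠] 0] fun y => y ^ j) :
    ∃ q : Polynomial ℝ,
      (fun y => f y - y ^ j * Polynomial.aeval y q) =O[𝓝[≠] 0] fun y => y ^ (j + m) := by
  induction j generalizing f with
  | zero =>
    simp only [pow_zero, one_mul, zero_add]
    clear hj
    induction m generalizing f with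
    | zero =>
      refine ⟨0, ?_⟩
      simp only [map_zero, sub_zero, pow_zero]
      exact (hf.continuousAt.tendsto.isBigO_one ℂ).mono nhdsWithin_le_nhds
    | succ m ih =>
      obtain ⟨q, hq⟩ := ih hf.dslope (eventually_dslope_im_eq_zero hf hreal)
      refine ⟨Polynomial.C (f 0).re + Polynomial.X * q, ?_⟩
      have h := (isBigO_refl (fun y : ℂ => y) (𝓝[≠] 0)).mul hq
      simp only [← pow_succ'] at h
      refine h.congr_left fun y => ?_
      have h0 : (((f 0).re : ℝ) : ℂ) = f 0 :=
        Complex.ext (by simp) (by simp [im_eq_zero_of_eventually hf hreal])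
      simp only [map_add, map_mul, Polynomial.aeval_X, Polynomial.aeval_C, Complex.coe_algebraMap,
        h0]
      rw [apply_eq_add_mul_dslope f y]; ring
  | succ j ih =>
    have hf0 : f 0 = 0 := by
      have h1 : Tendsto f (𝓝[≠] 0) (𝓝 0) := by
        refine hj.trans_tendsto ?_
        have : Tendsto (fun y : ℂ => y ^ (j + 1)) (𝓝 0) (𝓝 (0 ^ (j + 1))) :=
          (continuous_pow (j + 1)).tendsto 0
        rw [zero_pow (by omega)] at this
        exact this.mono_left nhdsWithin_le_nhds
      exact tendsto_nhds_unique (hf.continuousAt.tendsto.mono_left nhdsWithin_le_nhds) h1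
    obtain ⟨q, hq⟩ := ih hf.dslope (eventually_dslope_im_eq_zero hf hreal) (by
      have h := (isBigO_refl (fun y : ℂ => y⁻¹) (𝓝[≠] 0)).mul hj
      refine (h.congr' ?_ ?_)
      · filter_upwards [self_mem_nhdsWithin] with y hy
        rw [apply_eq_add_mul_dslope f y, hf0, zero_add, inv_mul_cancel_left₀ hy]
      · filter_upwards [self_mem_nhdsWithin] with y hy
        rw [pow_succ', inv_mul_cancel_left₀ hy])
    refine ⟨q, ?_⟩
    have h := (isBigO_refl (fun y : ℂ => y) (𝓝[≠] 0)).mul hq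
    refine (h.congr (fun y => ?_) fun y => ?_)
    · rw [apply_eq_add_mul_dslope f y, hf0]; ring
    · ring

/-! ### Expansion of the characteristic function at low frequencies -/

/-- The moment generating function, on the complex plane, of a law with finitely many atoms. -/
def atomicMGF {m : ℕ} (b p : Fin m → ℝ) (y : ℂ) : ℂ := ∑ i, p i * Complex.exp (y * b i)

section LowFrequency

variable {m : ℕ} {b p : Fin m → ℝ}

lemma atomicMGF_sub_isBigO (hp : ∑ i, p i = 1) (h1 : ∑ i, p i * b i = 0)
    (h2 : ∑ i, p i * b i ^ 2 = 1) :
    (fun y => atomicMGF b p y - 1 - y ^ 2 / 2) =O[𝓝 0] fun y => y ^ 3 := by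
  have e : ∀ y, atomicMGF b p y - 1 - y ^ 2 / 2 = ∑ i, p i *
      (Complex.exp (y * b i) - ∑ k ∈ Finset.range 3, (y * b i) ^ k / (k.factorial : ℂ)) := by
    intro y
    have e1 : (∑ i, (p i : ℂ)) = 1 := by exact_mod_cast hp
    have e2 : (∑ i, (p i : ℂ) * b i) = 0 := by exact_mod_cast h1
    have e3 : (∑ i, (p i : ℂ) * b i ^ 2) = 1 := by exact_mod_cast h2
    have e4 : ∑ i, (p i : ℂ) * (1 + y * b i + (y * b i) ^ 2 / 2) = 1 + y ^ 2 / 2 := by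
      calc _ = (∑ i, (p i : ℂ)) + y * (∑ i, (p i : ℂ) * b i)
            + y ^ 2 / 2 * ∑ i, (p i : ℂ) * b i ^ 2 := by
            rw [Finset.mul_sum, Finset.mul_sum, ← Finset.sum_add_distrib, ← Finset.sum_add_distrib]
            exact Finset.sum_congr rfl fun i _ => by ring
        _ = _ := by rw [e1, e2, e3]; ring
    simp only [Finset.sum_range_succ, Finset.sum_range_zero, mul_sub, Finset.sum_sub_distrib]
    rw [sub_sub, ← e4, atomicMGF]
    congr 1
    refine Finset.sum_congr rfl fun i _ => ?_
    norm_num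
  simp only [e]
  refine IsBigO.fun_sum fun i _ => IsBigO.const_mul_left ?_ _
  refine IsBigO.of_bound (|b i| ^ 3 * Real.exp |b i|) ?_
  filter_upwards [Metric.closedBall_mem_nhds (0 : ℂ) one_pos] with y hy
  rw [mem_closedBall_zero_iff] at hy
  refine (Complex.norm_exp_sub_sum_le_norm_mul_exp _ _).trans ?_
  rw [norm_mul, Complex.norm_real, Real.norm_eq_abs, mul_pow, norm_pow]
  have : ‖y‖ * |b i| ≤ |b i| := mul_le_of_le_one_left (abs_nonneg _) hy
  calc ‖y‖ ^ 3 * |b i| ^ 3 * Real.exp (‖y‖ * |b i|)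
      ≤ ‖y‖ ^ 3 * |b i| ^ 3 * Real.exp |b i| := by gcongr
    _ = _ := by ring

lemma analyticAt_atomicMGF : AnalyticAt ℂ (atomicMGF b p) 0 := by
  unfold atomicMGF
  fun_prop

lemma atomicMGF_zero (hp : ∑ i, p i = 1) : atomicMGF b p 0 = 1 := by
  simp only [atomicMGF, zero_mul, Complex.exp_zero, mul_one]
  exact_mod_cast hp

/-- The cumulant expansion: `log M(y) = y² / 2 + y³ q(y) + O(y ^ (r + 3))` with `q` a real
polynomial. -/
lemma exists_cumulant_expansion (hp0 : ∀ i, 0 < p i) (hp : ∑ i, p i = 1)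
    (h1 : ∑ i, p i * b i = 0) (h2 : ∑ i, p i * b i ^ 2 = 1) (r : ℕ) :
    ∃ (f : ℂ → ℂ) (q : Polynomial ℝ) (C δ : ℝ), 0 < C ∧ 0 < δ ∧ ∀ y : ℂ, ‖y‖ ≤ δ →
      atomicMGF b p y = Complex.exp (y ^ 2 / 2 + f y) ∧
      ‖f y - y ^ 3 * Polynomial.aeval y q‖ ≤ C * ‖y‖ ^ (r + 3) ∧
      ‖Polynomial.aeval y q‖ ≤ C := by
  set M := atomicMGF b p with hM
  set f : ℂ → ℂ := fun y => Complex.log (M y) - y ^ 2 / 2 with hf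
  have hM0 : M 0 = 1 := atomicMGF_zero hp
  have hMan : AnalyticAt ℂ M 0 := analyticAt_atomicMGF
  have hfan : AnalyticAt ℂ f 0 := by
    refine (hMan.clog ?_).sub (by fun_prop)
    rw [hM0]; exact Complex.one_mem_slitPlane
  have hreal : ∀ᶠ x : ℝ in 𝓝[≠] 0, (f x).im = 0 := by
    refine Eventually.of_forall fun x => ?_
    have e1 : M x = ((∑ i, p i * Real.exp (x * b i) : ℝ) : ℂ) := by
      rw [hM, atomicMGF]; push_cast; rfl
    have hpos : 0 ≤ ∑ i, p i * Real.exp (x * b i) :=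
      Finset.sum_nonneg fun i _ => by have := hp0 i; positivity
    have e2 : f x = ((Real.log (∑ i, p i * Real.exp (x * b i)) - x ^ 2 / 2 : ℝ) : ℂ) := by
      rw [hf]
      simp only
      rw [e1, ← Complex.ofReal_log hpos]
      push_cast; rfl
    rw [e2, Complex.ofReal_im]
  have hMt : Tendsto (fun y => M y - 1) (𝓝 0) (𝓝 0) := by
    have := (hMan.continuousAt.tendsto.sub_const 1)
    rwa [hM0, sub_self] at this
  have hO := atomicMGF_sub_isBigO hp h1 h2
  have hpow {i j : ℕ} (hij : j ≤ i) : (fun y : ℂ => y ^ i) =O[𝓝 0] fun y => y ^ j := by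
    refine IsBigO.of_bound 1 ?_
    filter_upwards [Metric.closedBall_mem_nhds (0 : ℂ) one_pos] with y hy
    rw [mem_closedBall_zero_iff] at hy
    rw [one_mul, norm_pow, norm_pow]
    exact pow_le_pow_of_le_one (norm_nonneg _) hy hij
  have hw : (fun y => M y - 1) =O[𝓝 0] fun y => y ^ 2 := by
    have h3 : (fun y : ℂ => y ^ 2 / 2) =O[𝓝 0] fun y => y ^ 2 := by
      simp only [div_eq_inv_mul]
      exact (isBigO_refl _ _).const_mul_left _
    refine ((hO.trans (hpow (by norm_num))).add h3).congr_left fun y => ?_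
    ring
  have hlog : (fun y => Complex.log (M y) - (M y - 1)) =O[𝓝 0] fun y => y ^ 3 := by
    have h3 : (fun w : ℂ => Complex.log (1 + w) - w) =O[𝓝 0] fun w => w ^ 2 := by
      refine IsBigO.of_bound 1 ?_
      filter_upwards [Metric.closedBall_mem_nhds (0 : ℂ) (ε := 1 / 2) (by norm_num)] with w hw
      rw [mem_closedBall_zero_iff] at hw
      refine (Complex.norm_log_one_add_sub_self_le (by linarith)).trans ?_
      have : (1 - ‖w‖)⁻¹ ≤ 2 := by
        rw [inv_le_comm₀ (by linarith) (by norm_num)]; linarith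
      rw [norm_pow]
      nlinarith [sq_nonneg ‖w‖]
    have h4 := (h3.comp_tendsto hMt).trans (hw.pow 2)
    simp only [← pow_mul] at h4
    refine (h4.trans (hpow (by norm_num : 3 ≤ 2 * 2))).congr_left fun y => ?_
    simp
  have hfO : f =O[𝓝 0] fun y => y ^ 3 := by
    refine (hlog.add hO).congr_left fun y => ?_
    simp only [hf]; ring
  obtain ⟨q, hq⟩ := exists_real_taylor r 3 hfan hreal (hfO.mono nhdsWithin_le_nhds)
  obtain ⟨C₁, hC₁⟩ := hq.bound
  obtain ⟨C₂, hC₂, hq2⟩ := exists_norm_aeval_le q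
  have hne : ∀ᶠ y in 𝓝 0, M y ≠ 0 := hMan.continuousAt.eventually_ne (by rw [hM0]; exact one_ne_zero)
  obtain ⟨δ, hδ, hball⟩ := Metric.eventually_nhds_iff_ball.1
    (hne.and (eventually_nhdsWithin_iff.1 hC₁))
  refine ⟨f, q, max C₁ (C₂ * Real.exp 1), min (δ / 2) 1, ?_, by positivity, fun y hy => ⟨?_, ?_, ?_⟩⟩
  · exact lt_of_lt_of_le (by positivity) (le_max_right _ _)
  · have hyb : y ∈ Metric.ball (0 : ℂ) δ := by
      rw [mem_ball_zero_iff]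
      linarith [hy.trans (min_le_left _ _)]
    simp only [hf]
    rw [add_sub_cancel, Complex.exp_log (hball y hyb).1]
  · have hyb : y ∈ Metric.ball (0 : ℂ) δ := by
      rw [mem_ball_zero_iff]
      linarith [hy.trans (min_le_left _ _)]
    rcases eq_or_ne y 0 with rfl | hy0
    · simp [hf, hM0]
    · refine ((hball y hyb).2 hy0).trans ?_
      rw [norm_pow, add_comm 3 r]
      gcongr
      exact le_max_left _ _
  · refine (hq2 y).trans (le_trans ?_ (le_max_right _ _))
    have : ‖y‖ ≤ 1 := hy.trans (min_le_right _ _)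
    gcongr
    nlinarith [norm_nonneg y]

/-- The polynomials `c_k` with `exp (x² y q(y)) = ∑ c_k(x) y^k + O(y^{r+1})`, packaged as the
coefficients of the bivariate polynomial obtained by truncating the exponential series. -/
lemma exists_expansion_coeff (q : Polynomial ℝ) (r : ℕ) :
    ∃ (c : ℕ → Polynomial ℝ) (C : ℝ), c 0 = 1 ∧ 0 < C ∧ ∀ x y : ℂ, ‖y‖ ≤ 1 →
      ‖∑ k ∈ Finset.range (r + 1), (x ^ 2 * (y * Polynomial.aeval y q)) ^ k / (k.factorial : ℂ)
        - ∑ k ∈ Finset.range (r + 1), Polynomial.aeval x (c k) * y ^ k‖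
        ≤ C * ‖y‖ ^ (r + 1) * Real.exp (‖x‖ ^ 2 / 8) := by
  let W : Polynomial (Polynomial ℝ) := ∑ k ∈ Finset.range (r + 1),
    Polynomial.C (Polynomial.C ((k.factorial : ℝ)⁻¹) * Polynomial.X ^ (2 * k)) *
      (Polynomial.X * q.map Polynomial.C) ^ k
  set N := W.natDegree + 1
  choose C hC hcoeff using fun k => exists_norm_aeval_le (W.coeff k)
  refine ⟨W.coeff, ∑ k ∈ Finset.range N, C (r + 1 + k), ?_,
    Finset.sum_pos (fun k _ => hC _) ⟨0, by simp [N]⟩, fun x y hy => ?_⟩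
  · rw [Polynomial.coeff_zero_eq_eval_zero, Polynomial.eval_finsetSum, Finset.sum_range_succ']
    simp
  have e1 : W.eval₂ (Polynomial.aeval x : Polynomial ℝ →ₐ[ℝ] ℂ).toRingHom y =
      ∑ k ∈ Finset.range (r + 1),
        (x ^ 2 * (y * Polynomial.aeval y q)) ^ k / (k.factorial : ℂ) := by
    simp only [W, Polynomial.eval₂_finsetSum, Polynomial.eval₂_mul, Polynomial.eval₂_C,
      Polynomial.eval₂_pow, Polynomial.eval₂_X]
    refine Finset.sum_congr rfl fun k _ => ?_
    have e2 : (q.map Polynomial.C).eval₂ (Polynomial.aeval x : Polynomial ℝ →ₐ[ℝ] ℂ).toRingHom y =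
        Polynomial.aeval y q := by
      rw [Polynomial.eval₂_map, Polynomial.aeval_def]
      congr 1
      ext a
      simp
    rw [e2]
    simp
    ring
  have e3 : W.eval₂ (Polynomial.aeval x : Polynomial ℝ →ₐ[ℝ] ℂ).toRingHom y =
      ∑ k ∈ Finset.range (r + 1 + N), Polynomial.aeval x (W.coeff k) * y ^ k := by
    rw [Polynomial.eval₂_eq_sum_range' _ (n := r + 1 + N) (by omega)]
    rfl
  rw [← e1, e3, Finset.sum_range_add, add_sub_cancel_left, Finset.sum_mul, Finset.sum_mul]
  refine (norm_sum_le _ _).trans (Finset.sum_le_sum fun k _ => ?_)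
  rw [norm_mul, norm_pow]
  calc ‖Polynomial.aeval x (W.coeff (r + 1 + k))‖ * ‖y‖ ^ (r + 1 + k)
      ≤ (C (r + 1 + k) * Real.exp (‖x‖ ^ 2 / 8)) * ‖y‖ ^ (r + 1) := by
        refine mul_le_mul (hcoeff _ x) (pow_le_pow_of_le_one (norm_nonneg _) hy (by omega))
          (by positivity) ?_
        have := hC (r + 1 + k)
        positivity
    _ = _ := by ring

/-- A perturbed truncated exponential series. -/
lemma norm_exp_sub_sum_perturb_le (v w : ℂ) (r : ℕ) :
    ‖Complex.exp v - ∑ k ∈ Finset.range (r + 1), w ^ k / (k.factorial : ℂ)‖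
      ≤ (‖v - w‖ + ‖w‖ ^ (r + 1)) * Real.exp (‖w‖ + ‖v - w‖) := by
  have h1 := Complex.norm_exp_sub_sum_le_norm_mul_exp w (r + 1)
  have h2 : ‖Complex.exp v - Complex.exp w‖ ≤ ‖v - w‖ * Real.exp (‖w‖ + ‖v - w‖) := by
    have e : Complex.exp v - Complex.exp w = Complex.exp w * (Complex.exp (v - w) - 1) := by
      rw [mul_sub, ← Complex.exp_add]; ring_nf
    have h3 := Complex.norm_exp_sub_sum_le_norm_mul_exp (v - w) 1
    simp only [Finset.range_one, Finset.sum_singleton, pow_zero, Nat.factorial_zero, Nat.cast_one,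
      div_one, pow_one] at h3
    rw [e, norm_mul]
    calc _ ≤ Real.exp ‖w‖ * (‖v - w‖ * Real.exp ‖v - w‖) := by
          gcongr
          exact Complex.norm_exp_le_exp_norm w
      _ = _ := by rw [Real.exp_add]; ring
  calc _ = ‖(Complex.exp v - Complex.exp w) + (Complex.exp w -
        ∑ k ∈ Finset.range (r + 1), w ^ k / (k.factorial : ℂ))‖ := by congr 1; ring
    _ ≤ _ := norm_add_le _ _
    _ ≤ ‖v - w‖ * Real.exp (‖w‖ + ‖v - w‖) + ‖w‖ ^ (r + 1) * Real.exp (‖w‖ + ‖v - w‖) := by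
        refine add_le_add h2 (h1.trans ?_)
        gcongr
        linarith [norm_nonneg (v - w)]
    _ = _ := by ring

/-- The Edgeworth expansion of `M(x / √n)^n` in powers of `x / √n`, uniform for `‖x‖ ≤ δ √n`. -/
lemma exists_mgf_pow_expansion (hp0 : ∀ i, 0 < p i) (hp : ∑ i, p i = 1)
    (h1 : ∑ i, p i * b i = 0) (h2 : ∑ i, p i * b i ^ 2 = 1) (r : ℕ) :
    ∃ (c : ℕ → Polynomial ℝ) (C δ : ℝ), c 0 = 1 ∧ 0 < C ∧ 0 < δ ∧ ∀ n : ℕ, 0 < n → ∀ x : ℂ,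
      ‖x‖ ≤ δ * √(n : ℝ) →
      ‖atomicMGF b p (x / (√(n : ℝ) : ℝ)) ^ n - Complex.exp (x ^ 2 / 2) *
        ∑ k ∈ Finset.range (r + 1), Polynomial.aeval x (c k) * (x / (√(n : ℝ) : ℝ)) ^ k‖
      ≤ ‖Complex.exp (x ^ 2 / 2)‖ * (C * (‖x‖ / √(n : ℝ)) ^ (r + 1) * Real.exp (‖x‖ ^ 2 / 4)) := by
  obtain ⟨f, q, C₁, δ₁, hC₁, hδ₁, hf⟩ := exists_cumulant_expansion hp0 hp h1 h2 r
  obtain ⟨c, C₂, hc0, hC₂, hc⟩ := exists_expansion_coeff q r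
  obtain ⟨C₃, hC₃, hpoly⟩ := exists_abs_eval_le
    (Polynomial.C C₁ * Polynomial.X ^ 2 + Polynomial.C (C₁ ^ (r + 1)) * Polynomial.X ^ (2 * (r + 1)))
  -- `δ ≤ 1 / (16 C₁)` makes both `‖w‖` and `‖n * f y - w‖` below at most `‖x‖² / 16`
  refine ⟨c, C₃ + C₂, min δ₁ (min 1 (1 / (16 * C₁))), hc0, by positivity, by positivity,
    fun n hn x hx => ?_⟩
  have hn' : (0 : ℝ) < n := by exact_mod_cast hn
  have hsq : 0 < √(n : ℝ) := Real.sqrt_pos.2 hn'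
  set y : ℂ := x / (√(n : ℝ) : ℝ) with hy
  have hynorm : ‖y‖ = ‖x‖ / √(n : ℝ) := by
    rw [hy, norm_div, Complex.norm_real, Real.norm_of_nonneg hsq.le]
  have hyδ : ‖y‖ ≤ min δ₁ (min 1 (1 / (16 * C₁))) := by
    rw [hynorm, div_le_iff₀ hsq]; exact hx
  have hy1 : ‖y‖ ≤ 1 := hyδ.trans ((min_le_right _ _).trans (min_le_left _ _))
  have hy16 : C₁ * ‖y‖ ≤ 1 / 16 := by
    have := hyδ.trans ((min_le_right _ _).trans (min_le_right _ _))
    rw [le_div_iff₀ (by positivity)] at this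
    linarith
  obtain ⟨hM, hfq, hq⟩ := hf y (hyδ.trans (min_le_left _ _))
  have hny : (n : ℂ) * y ^ 2 = x ^ 2 := by
    have h3 : (((√(n : ℝ)) : ℝ) : ℂ) ^ 2 = n := by
      rw [← Complex.ofReal_pow, Real.sq_sqrt hn'.le]; simp
    have h4 : (n : ℂ) ≠ 0 := by exact_mod_cast hn.ne'
    rw [hy, div_pow, h3]; field_simp
  have hnyr : (n : ℝ) * ‖y‖ ^ 2 = ‖x‖ ^ 2 := by
    rw [hynorm, div_pow, Real.sq_sqrt hn'.le]; field_simp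
  have hpow : atomicMGF b p y ^ n = Complex.exp (x ^ 2 / 2) * Complex.exp (n * f y) := by
    rw [hM, ← Complex.exp_nat_mul, ← Complex.exp_add, ← hny]; ring_nf
  set w : ℂ := x ^ 2 * (y * Polynomial.aeval y q) with hw
  have hwle : ‖w‖ ≤ C₁ * ‖x‖ ^ 2 * ‖y‖ := by
    rw [hw, norm_mul, norm_mul, norm_pow]
    calc ‖x‖ ^ 2 * (‖y‖ * ‖Polynomial.aeval y q‖) ≤ ‖x‖ ^ 2 * (‖y‖ * C₁) := by gcongr
      _ = _ := by ring
  have hvw : ‖n * f y - w‖ ≤ C₁ * ‖x‖ ^ 2 * ‖y‖ ^ (r + 1) := by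
    have e : n * f y - w = n * (f y - y ^ 3 * Polynomial.aeval y q) := by
      rw [hw, ← hny]; ring
    rw [e, norm_mul, Complex.norm_natCast]
    calc (n : ℝ) * ‖f y - y ^ 3 * Polynomial.aeval y q‖ ≤ n * (C₁ * ‖y‖ ^ (r + 3)) := by gcongr
      _ = C₁ * (n * ‖y‖ ^ 2) * ‖y‖ ^ (r + 1) := by ring
      _ = _ := by rw [hnyr]
  have hy_pow : ‖y‖ ^ (r + 1) ≤ ‖y‖ := by
    simpa using pow_le_pow_of_le_one (norm_nonneg y) hy1 (by omega : 1 ≤ r + 1)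
  have hexp : ‖w‖ + ‖n * f y - w‖ ≤ ‖x‖ ^ 2 / 8 := by
    have h3 : C₁ * ‖x‖ ^ 2 * ‖y‖ ≤ ‖x‖ ^ 2 / 16 := by nlinarith [sq_nonneg ‖x‖]
    have h4 : C₁ * ‖x‖ ^ 2 * ‖y‖ ^ (r + 1) ≤ C₁ * ‖x‖ ^ 2 * ‖y‖ := by gcongr
    linarith
  have hmain : ‖Complex.exp (n * f y) - ∑ k ∈ Finset.range (r + 1), w ^ k / (k.factorial : ℂ)‖
      ≤ C₃ * ‖y‖ ^ (r + 1) * Real.exp (‖x‖ ^ 2 / 4) := by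
    refine (norm_exp_sub_sum_perturb_le _ w r).trans ?_
    have h5 := (le_abs_self _).trans (hpoly ‖x‖)
    simp only [Polynomial.eval_add, Polynomial.eval_mul, Polynomial.eval_C, Polynomial.eval_pow,
      Polynomial.eval_X] at h5
    have h6 : ‖w‖ ^ (r + 1) ≤ C₁ ^ (r + 1) * ‖x‖ ^ (2 * (r + 1)) * ‖y‖ ^ (r + 1) := by
      calc ‖w‖ ^ (r + 1) ≤ (C₁ * ‖x‖ ^ 2 * ‖y‖) ^ (r + 1) := by gcongr
        _ = _ := by rw [mul_pow, mul_pow, ← pow_mul]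
    calc (‖n * f y - w‖ + ‖w‖ ^ (r + 1)) * Real.exp (‖w‖ + ‖n * f y - w‖)
        ≤ (C₁ * ‖x‖ ^ 2 * ‖y‖ ^ (r + 1) + C₁ ^ (r + 1) * ‖x‖ ^ (2 * (r + 1)) * ‖y‖ ^ (r + 1)) *
            Real.exp (‖x‖ ^ 2 / 8) := by gcongr
      _ = (C₁ * ‖x‖ ^ 2 + C₁ ^ (r + 1) * ‖x‖ ^ (2 * (r + 1))) * ‖y‖ ^ (r + 1) *
            Real.exp (‖x‖ ^ 2 / 8) := by ring
      _ ≤ (C₃ * Real.exp (‖x‖ ^ 2 / 8)) * ‖y‖ ^ (r + 1) * Real.exp (‖x‖ ^ 2 / 8) := by gcongr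
      _ = C₃ * ‖y‖ ^ (r + 1) * Real.exp (‖x‖ ^ 2 / 8 + ‖x‖ ^ 2 / 8) := by rw [Real.exp_add]; ring
      _ = _ := by ring_nf
  rw [hpow, ← mul_sub, norm_mul, ← hynorm]
  gcongr
  calc _ = ‖(Complex.exp (n * f y) - ∑ k ∈ Finset.range (r + 1), w ^ k / (k.factorial : ℂ)) +
        (∑ k ∈ Finset.range (r + 1), w ^ k / (k.factorial : ℂ) -
          ∑ k ∈ Finset.range (r + 1), Polynomial.aeval x (c k) * y ^ k)‖ := by congr 1; ring
    _ ≤ _ := norm_add_le _ _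
    _ ≤ C₃ * ‖y‖ ^ (r + 1) * Real.exp (‖x‖ ^ 2 / 4)
        + C₂ * ‖y‖ ^ (r + 1) * Real.exp (‖x‖ ^ 2 / 8) := add_le_add hmain (hc x y hy1)
    _ ≤ C₃ * ‖y‖ ^ (r + 1) * Real.exp (‖x‖ ^ 2 / 4)
        + C₂ * ‖y‖ ^ (r + 1) * Real.exp (‖x‖ ^ 2 / 4) := by
        gcongr; linarith [sq_nonneg ‖x‖]
    _ = _ := by ring

end LowFrequency

/-! ### Existence of the Edgeworth series -/

section AtomicLaw

variable {m : ℕ} {a p : Fin m → ℝ}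

lemma integral_atomicLaw {F : Type*} [NormedAddCommGroup F] [NormedSpace ℝ F]
    [CompleteSpace F] (hp : ∀ i, 0 < p i) (g : ℝ → F) : ∫ x, g x ∂atomicLaw a p = ∑ i, p i • g (a i) := by
  rw [atomicLaw, integral_finsetSum_measure]
  · refine Finset.sum_congr rfl fun i _ => ?_
    rw [integral_smul_measure, integral_dirac, ENNReal.toReal_ofReal (hp i).le]
  · exact fun i _ => (integrable_dirac (by simp)).smul_measure ENNReal.ofReal_ne_top

lemma isProbabilityMeasure_atomicLaw (h : IsCenteredParam a p) :
    IsProbabilityMeasure (atomicLaw a p) := by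
  constructor
  simp only [atomicLaw, Measure.coe_finsetSum, Finset.sum_apply, Measure.smul_apply, smul_eq_mul,
    measure_univ, mul_one]
  rw [← ENNReal.ofReal_sum_of_nonneg fun i _ => (h.1 i).le, h.2.1, ENNReal.ofReal_one]

lemma stdDev_atomicLaw (h : IsCenteredParam a p) :
    stdDev (atomicLaw a p) = √(∑ i, p i * a i ^ 2) := by
  have hmean : ∫ x, id x ∂atomicLaw a p = 0 := by
    rw [integral_atomicLaw h.1]; simpa using h.2.2
  rw [stdDev, variance_of_integral_eq_zero aemeasurable_id hmean, integral_atomicLaw h.1]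
  simp

lemma sum_mul_sq_pos (h : IsCenteredParam a p) (hne : ∃ i j, a i ≠ a j) :
    0 < ∑ i, p i * a i ^ 2 := by
  have : ∃ i, a i ≠ 0 := by
    by_contra! h0
    obtain ⟨i, j, hij⟩ := hne
    exact hij (by rw [h0 i, h0 j])
  obtain ⟨i, hi⟩ := this
  refine Finset.sum_pos' (fun j _ => ?_) ⟨i, Finset.mem_univ _, ?_⟩
  · have := h.1 j; positivity
  · have := h.1 i; positivity

lemma charFun_atomicLaw (hp : ∀ i, 0 < p i) (t : ℝ) :
    charFun (atomicLaw a p) t = ∑ i, p i * Complex.exp (t * a i * Complex.I) := by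
  rw [charFun_apply_real, integral_atomicLaw hp]
  simp

/-- The Edgeworth polynomials exist, and the expansion of the characteristic function that defines
them is uniform in the range `|t| ≤ δ √n`. -/
theorem exists_edgeworth_low_frequency (h : IsCenteredParam a p) (hne : ∃ i j, a i ≠ a j) (r : ℕ) :
    ∃ (P : Fin r → Polynomial ℝ) (C δ : ℝ), 0 < C ∧ 0 < δ ∧ ∀ n : ℕ, 0 < n → ∀ t : ℝ,
      |t| ≤ δ * √(n : ℝ) →
      ‖charFun (atomicLaw a p) (t / (stdDev (atomicLaw a p) * √(n : ℝ))) ^ n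
        - edgeworthFourier P n t‖
      ≤ C * (|t| / √(n : ℝ)) ^ (r + 1) * Real.exp (-(1 / 4) * t ^ 2) := by
  have hpos := sum_mul_sq_pos h hne
  rw [stdDev_atomicLaw h]
  set σ := √(∑ i, p i * a i ^ 2) with hσ
  obtain ⟨c, C, δ, hc0, hC, hδ, hmain⟩ := exists_mgf_pow_expansion (b := fun i => a i / σ) h.1 h.2.1
    (by simp only [← mul_div_assoc, ← Finset.sum_div, h.2.2, zero_div])
    (by simp only [div_pow, ← mul_div_assoc, ← Finset.sum_div]
        rw [hσ, Real.sq_sqrt hpos.le, div_self hpos.ne']) r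
  refine ⟨fun k => -hermiteExpansion (Polynomial.X ^ (k : ℕ) * c (k + 1)), C, δ, hC, hδ,
    fun n hn t ht => ?_⟩
  have hn' : (0 : ℝ) < n := by exact_mod_cast hn
  have hnorm : ‖(t : ℂ) * Complex.I‖ = |t| := by simp
  have h1 := hmain n hn (t * Complex.I) (by rwa [hnorm])
  have e1 : atomicMGF (fun i => a i / σ) p (t * Complex.I / (√(n : ℝ) : ℝ)) =
      charFun (atomicLaw a p) (t / (σ * √(n : ℝ))) := by
    rw [charFun_atomicLaw h.1, atomicMGF]
    refine Finset.sum_congr rfl fun i _ => ?_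
    congr 2
    push_cast
    field_simp
  have e2 : ((t : ℂ) * Complex.I) ^ 2 = -(t : ℂ) ^ 2 := by
    rw [mul_pow, Complex.I_sq]; ring
  have e3 : Complex.exp (((t : ℂ) * Complex.I) ^ 2 / 2) * ∑ k ∈ Finset.range (r + 1),
      Polynomial.aeval ((t : ℂ) * Complex.I) (c k) * (t * Complex.I / (√(n : ℝ) : ℝ)) ^ k =
      edgeworthFourier (fun k : Fin r => -hermiteExpansion (Polynomial.X ^ (k : ℕ) * c (k + 1)))
        n t := by
    rw [edgeworthFourier_eq, Finset.sum_range_succ', hc0, e2, map_one, pow_zero, mul_one, add_comm,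
      mul_add, mul_one, sub_eq_add_neg, ← Finset.sum_neg_distrib, Finset.mul_sum,
      ← Fin.sum_univ_eq_sum_range (n := r) fun k => Complex.exp (-(t : ℂ) ^ 2 / 2) *
        (Polynomial.aeval ((t : ℂ) * Complex.I) (c (k + 1)) *
          (t * Complex.I / (√(n : ℝ) : ℝ)) ^ (k + 1))]
    congr 1
    refine Finset.sum_congr rfl fun k _ => ?_
    have e4 : gaussTransform (-hermiteExpansion (Polynomial.X ^ (k : ℕ) * c (k + 1))) t =
        -gaussTransform (hermiteExpansion (Polynomial.X ^ (k : ℕ) * c (k + 1))) t :=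
      map_neg (gaussTransformₗ t) _
    have e5 : (n : ℝ) ^ ((((k : ℕ) : ℝ) + 1) / 2) = √(n : ℝ) ^ ((k : ℕ) + 1) := by
      rw [Real.sqrt_eq_rpow, ← Real.rpow_mul_natCast hn'.le]
      congr 1; push_cast; ring
    rw [e4, gaussTransform_hermiteExpansion, map_mul, map_pow, Polynomial.aeval_X, e5, div_pow]
    push_cast
    rw [pow_succ ((t : ℂ) * Complex.I)]
    ring
  rw [e1, e3, hnorm, e2] at h1
  refine h1.trans (le_of_eq ?_)
  have h2 : ‖Complex.exp (-(t : ℂ) ^ 2 / 2)‖ = Real.exp (-t ^ 2 / 2) := by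
    rw [Complex.norm_exp]; norm_cast
  rw [h2, sq_abs, mul_comm, mul_assoc, ← Real.exp_add]
  ring_nf

lemma isEdgeworthSeries_of_low_frequency {r : ℕ} {P : Fin r → Polynomial ℝ} {C δ : ℝ} (hδ : 0 < δ)
    (hP : ∀ n : ℕ, 0 < n → ∀ t : ℝ, |t| ≤ δ * √(n : ℝ) →
      ‖charFun (atomicLaw a p) (t / (stdDev (atomicLaw a p) * √(n : ℝ))) ^ n
        - edgeworthFourier P n t‖
      ≤ C * (|t| / √(n : ℝ)) ^ (r + 1) * Real.exp (-(1 / 4) * t ^ 2)) (hC : 0 < C) :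
    IsEdgeworthSeries (atomicLaw a p) P := by
  intro t
  have h1 : (fun n : ℕ => charFun (atomicLaw a p) (t / (stdDev (atomicLaw a p) * √(n : ℝ))) ^ n
      - edgeworthFourier P n t) =O[atTop] fun n : ℕ => (n : ℝ) ^ (-(((r : ℝ) + 1) / 2)) := by
    refine IsBigO.of_bound (C * |t| ^ (r + 1)) ?_
    have ht : ∀ᶠ n : ℕ in atTop, |t| / δ ≤ √(n : ℝ) :=
      (Real.tendsto_sqrt_atTop.comp tendsto_natCast_atTop_atTop).eventually_ge_atTop _
    filter_upwards [ht, eventually_gt_atTop 0] with n hn hn0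
    rw [div_le_iff₀' hδ] at hn
    refine (hP n hn0 t hn).trans ?_
    have hn' : (0 : ℝ) < n := by exact_mod_cast hn0
    have e : (n : ℝ) ^ (-(((r : ℝ) + 1) / 2)) = (√(n : ℝ) ^ (r + 1))⁻¹ := by
      rw [Real.rpow_neg hn'.le, Real.sqrt_eq_rpow, ← Real.rpow_mul_natCast hn'.le]
      congr 2; push_cast; ring
    rw [e, Real.norm_of_nonneg (by positivity), div_pow]
    calc C * (|t| ^ (r + 1) / √(n : ℝ) ^ (r + 1)) * Real.exp (-(1 / 4) * t ^ 2)
        ≤ C * (|t| ^ (r + 1) / √(n : ℝ) ^ (r + 1)) * 1 := by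
          gcongr
          exact Real.exp_le_one_iff.2 (by nlinarith [sq_nonneg t])
      _ = _ := by ring
  refine h1.trans_isLittleO ?_
  have hhalf : Tendsto (fun n : ℕ => (n : ℝ) ^ (-(1 / 2 : ℝ))) atTop (𝓝 0) :=
    (tendsto_rpow_neg_atTop (by norm_num)).comp tendsto_natCast_atTop_atTop
  have h2 := (isBigO_refl (fun n : ℕ => (n : ℝ) ^ (-((r : ℝ) / 2))) atTop).mul_isLittleO
    ((isLittleO_one_iff ℝ).2 hhalf)
  refine h2.congr' ?_ (by simp)
  filter_upwards [eventually_gt_atTop 0] with n hn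
  rw [← Real.rpow_add (by exact_mod_cast hn)]
  congr 1; ring

theorem existsUnique_isEdgeworthSeries (h : IsCenteredParam a p) (hne : ∃ i j, a i ≠ a j) (r : ℕ) :
    ∃! P : Fin r → Polynomial ℝ, IsEdgeworthSeries (atomicLaw a p) P := by
  obtain ⟨P, C, δ, hC, hδ, hP⟩ := exists_edgeworth_low_frequency h hne r
  have hser := isEdgeworthSeries_of_low_frequency hδ hP hC
  exact ⟨P, hser, fun Q hQ => hQ.unique hser⟩

theorem IsEdgeworthSeries.low_frequency {r : ℕ} {P : Fin r → Polynomial ℝ}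
    (hP : IsEdgeworthSeries (atomicLaw a p) P) (h : IsCenteredParam a p) (hne : ∃ i j, a i ≠ a j) :
    ∃ C δ : ℝ, 0 < C ∧ 0 < δ ∧ ∀ n : ℕ, 0 < n → ∀ t : ℝ, |t| ≤ δ * √(n : ℝ) →
      ‖charFun (atomicLaw a p) (t / (stdDev (atomicLaw a p) * √(n : ℝ))) ^ n
        - edgeworthFourier P n t‖
      ≤ C * (|t| / √(n : ℝ)) ^ (r + 1) * Real.exp (-(1 / 4) * t ^ 2) := by
  obtain ⟨Q, C, δ, hC, hδ, hQ⟩ := exists_edgeworth_low_frequency h hne r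
  rw [hP.unique (isEdgeworthSeries_of_low_frequency hδ hQ hC)]
  exact ⟨C, δ, hC, hδ, hQ⟩

end AtomicLaw

/-! ### Gaussian smoothing of indicator functions -/

open scoped NNReal

/-- The indicator function of `(a, b]` convolved with the centered Gaussian law of variance `v`. -/
def smoothInd (v : ℝ≥0) (a b x : ℝ) : ℝ := (gaussianReal x v).real (Set.Ioc a b)

lemma smoothInd_nonneg (v : ℝ≥0) (a b x : ℝ) : 0 ≤ smoothInd v a b x := measureReal_nonneg

lemma smoothInd_le_one (v : ℝ≥0) (a b x : ℝ) : smoothInd v a b x ≤ 1 := measureReal_le_one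

lemma gaussianReal_upper_tail_le {v : ℝ≥0} (hv : v ≠ 0) (x : ℝ) {h : ℝ} (hh : 0 ≤ h) :
    (gaussianReal x v).real {u | x + h ≤ u} ≤ Real.exp (-h ^ 2 / (2 * v)) := by
  have := measure_ge_le_exp_mul_mgf (X := id) (μ := gaussianReal x v) (x + h) (t := h / v)
    (by positivity) (integrable_exp_mul_gaussianReal _)
  rw [mgf_id_gaussianReal, ← Real.exp_add] at this
  refine this.trans (le_of_eq ?_)
  congr 1
  field_simp
  ring

lemma gaussianReal_lower_tail_le {v : ℝ≥0} (hv : v ≠ 0) (x : ℝ) {h : ℝ} (hh : 0 ≤ h) :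
    (gaussianReal x v).real {u | u ≤ x - h} ≤ Real.exp (-h ^ 2 / (2 * v)) := by
  have := measure_le_le_exp_mul_mgf (X := id) (μ := gaussianReal x v) (x - h) (t := -(h / v))
    (by rw [neg_nonpos]; positivity) (integrable_exp_mul_gaussianReal _)
  rw [mgf_id_gaussianReal, ← Real.exp_add] at this
  refine this.trans (le_of_eq ?_)
  congr 1
  field_simp
  ring

/-- The smoothed indicator of `(a, b]` is nearly `1` well inside the interval. -/
lemma one_sub_le_smoothInd {v : ℝ≥0} (hv : v ≠ 0) {h : ℝ} (hh : 0 ≤ h) {a b x : ℝ}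
    (hax : a + h < x) (hxb : x + h ≤ b) :
    1 - 2 * Real.exp (-h ^ 2 / (2 * v)) ≤ smoothInd v a b x := by
  have hup := gaussianReal_upper_tail_le hv x hh
  have hlow := gaussianReal_lower_tail_le hv x hh
  have hsub : (Set.Ioc a b)ᶜ ⊆ {u | x + h ≤ u} ∪ {u | u ≤ x - h} := by
    intro u hu
    simp only [Set.mem_compl_iff, Set.mem_Ioc, not_and_or, not_lt, not_le] at hu
    rcases hu with hu | hu
    · exact Or.inr (show u ≤ x - h by linarith)
    · exact Or.inl (show x + h ≤ u by linarith)
  have h1 := probReal_compl_eq_one_sub (μ := gaussianReal x v) (measurableSet_Ioc (a := a) (b := b))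
  rw [smoothInd]
  linarith [(measureReal_mono (μ := gaussianReal x v) hsub).trans (measureReal_union_le _ _)]

/-- The smoothed indicator of `(a, b]` is nearly `0` well above the interval. -/
lemma smoothInd_le_of_add_le {v : ℝ≥0} (hv : v ≠ 0) {h : ℝ} (hh : 0 ≤ h) {a b x : ℝ}
    (hxb : b + h ≤ x) : smoothInd v a b x ≤ 2 * Real.exp (-h ^ 2 / (2 * v)) := by
  have hlow := gaussianReal_lower_tail_le hv x hh
  have hsub : Set.Ioc a b ⊆ {u | u ≤ x - h} := fun u hu =>
    show u ≤ x - h by linarith [hu.2]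
  have := measureReal_mono (μ := gaussianReal x v) hsub
  rw [smoothInd]
  linarith [Real.exp_pos (-h ^ 2 / (2 * v))]

/-- The smoothed indicator of `(a, b]` is close to the indicator of `(-∞, z]`, away from `z` and
above `a`. -/
lemma abs_smoothInd_sub_indicator_le {v : ℝ≥0} (hv : v ≠ 0) {h : ℝ} (hh : 0 ≤ h) {a b z : ℝ}
    (hbz : |b - z| ≤ h) (x : ℝ) :
    |smoothInd v a b x - (Set.Iic z).indicator 1 x| ≤ 2 * Real.exp (-h ^ 2 / (2 * v)) +
      (Set.Icc (z - 2 * h) (z + 2 * h)).indicator 1 x + (Set.Iic (a + h)).indicator 1 x := by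
  have hT0 := Real.exp_pos (-h ^ 2 / (2 * v))
  have h0 := smoothInd_nonneg v a b x
  have h1 := smoothInd_le_one v a b x
  have hi (s : Set ℝ) : 0 ≤ s.indicator (1 : ℝ → ℝ) x :=
    Set.indicator_nonneg (fun _ _ => zero_le_one) x
  obtain ⟨hb1, hb2⟩ := abs_le.1 hbz
  have htriv : |smoothInd v a b x - (Set.Iic z).indicator 1 x| ≤ 1 := by
    by_cases hx : x ∈ Set.Iic z
    · rw [Set.indicator_of_mem hx, Pi.one_apply, abs_le]; constructor <;> linarith
    · rw [Set.indicator_of_notMem hx, abs_le]; constructor <;> linarith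
  by_cases hx1 : x ∈ Set.Icc (z - 2 * h) (z + 2 * h)
  · rw [Set.indicator_of_mem hx1, Pi.one_apply]
    linarith [hi (Set.Iic (a + h))]
  by_cases hx2 : x ∈ Set.Iic (a + h)
  · rw [Set.indicator_of_mem hx2, Pi.one_apply]
    linarith [hi (Set.Icc (z - 2 * h) (z + 2 * h))]
  rw [Set.indicator_of_notMem hx1, Set.indicator_of_notMem hx2, add_zero, add_zero]
  rw [Set.mem_Iic, not_le] at hx2
  rw [Set.mem_Icc, not_and_or, not_le, not_le] at hx1
  rcases hx1 with hx | hx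
  · rw [Set.indicator_of_mem (by rw [Set.mem_Iic]; linarith), Pi.one_apply, abs_sub_comm,
      abs_of_nonneg (by linarith)]
    linarith [one_sub_le_smoothInd hv hh hx2 (b := b) (by linarith)]
  · rw [Set.indicator_of_notMem (by rw [Set.mem_Iic]; linarith), sub_zero, abs_of_nonneg h0]
    exact smoothInd_le_of_add_le hv hh (by linarith)

/-- The Gaussian density as the Fourier transform of a Gaussian law. -/
lemma gaussianPDFReal_eq_integral_exp {v : ℝ≥0} (hv : v ≠ 0) (x y : ℝ) :
    (gaussianPDFReal x v y : ℂ) = ((√(2 * Real.pi * v))⁻¹ : ℝ) *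
      ∫ t : ℝ, Complex.exp ((x - y : ℝ) * (t : ℂ) * Complex.I) ∂gaussianReal 0 v⁻¹ := by
  rw [← charFun_apply_real, charFun_gaussianReal, gaussianPDFReal]
  push_cast
  congr 2
  have : (v : ℂ) ≠ 0 := by exact_mod_cast hv
  field_simp
  ring

/-- The Fourier transform of the indicator function of `(a, b]`. -/
def intervalFourier (a b t : ℝ) : ℂ := ∫ y in a..b, Complex.exp (-(t * Complex.I) * (y : ℂ))

lemma norm_exp_neg_mul_I (t y : ℝ) : ‖Complex.exp (-(t * Complex.I) * (y : ℂ))‖ = 1 := by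
  rw [show -((t : ℂ) * Complex.I) * (y : ℂ) = ((-(t * y) : ℝ) : ℂ) * Complex.I by push_cast; ring,
    Complex.norm_exp_ofReal_mul_I]

lemma norm_intervalFourier_le (a b t : ℝ) : ‖intervalFourier a b t‖ ≤ |b - a| := by
  have := intervalIntegral.norm_integral_le_of_norm_le_const (a := a) (b := b) (C := 1)
    (f := fun y : ℝ => Complex.exp (-(t * Complex.I) * (y : ℂ)))
    fun y _ => (norm_exp_neg_mul_I t y).le
  rwa [one_mul] at this

lemma abs_mul_norm_intervalFourier_le (a b t : ℝ) : |t| * ‖intervalFourier a b t‖ ≤ 2 := by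
  rcases eq_or_ne t 0 with rfl | ht
  · simp
  have ht' : (t : ℂ) ≠ 0 := by exact_mod_cast ht
  rw [intervalFourier, integral_exp_mul_complex (neg_ne_zero.2 (mul_ne_zero ht' Complex.I_ne_zero)),
    norm_div, norm_neg, norm_mul, Complex.norm_I, mul_one, Complex.norm_real, Real.norm_eq_abs,
    mul_div_cancel₀ _ (abs_ne_zero.2 ht)]
  refine (norm_sub_le _ _).trans ?_
  rw [norm_exp_neg_mul_I, norm_exp_neg_mul_I]
  norm_num

lemma continuous_intervalFourier (a b : ℝ) : Continuous (intervalFourier a b) := by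
  unfold intervalFourier
  exact intervalIntegral.continuous_parametric_intervalIntegral_of_continuous' (by fun_prop) _ _

lemma smoothInd_eq_integral {v : ℝ≥0} (hv : v ≠ 0) {a b : ℝ} (hab : a ≤ b) (x : ℝ) :
    (smoothInd v a b x : ℂ) = ((√(2 * Real.pi * v))⁻¹ : ℝ) * ∫ t : ℝ,
      Complex.exp ((t : ℂ) * (x : ℂ) * Complex.I) * intervalFourier a b t ∂gaussianReal 0 v⁻¹ := by
  have h1 : smoothInd v a b x = ∫ y in a..b, gaussianPDFReal x v y := by
    rw [smoothInd, measureReal_def, gaussianReal_apply_eq_integral _ hv, ENNReal.toReal_ofReal,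
      intervalIntegral.integral_of_le hab]
    exact integral_nonneg fun y => gaussianPDFReal_nonneg _ _ _
  have hsplit (y t : ℝ) : Complex.exp ((x - y : ℝ) * (t : ℂ) * Complex.I) =
      Complex.exp ((t : ℂ) * (x : ℂ) * Complex.I) * Complex.exp (-(t * Complex.I) * (y : ℂ)) := by
    rw [← Complex.exp_add]; push_cast; ring_nf
  rw [h1, ← intervalIntegral.integral_ofReal]
  simp only [gaussianPDFReal_eq_integral_exp hv, hsplit]
  rw [intervalIntegral.integral_const_mul]
  congr 1
  rw [intervalIntegral_integral_swap]
  · simp only [intervalIntegral.integral_const_mul, intervalFourier]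
  · have : IsFiniteMeasure (volume.restrict (Set.uIoc a b)) := ⟨by simp [Set.uIoc]⟩
    refine Integrable.of_bound (C := 1) (Continuous.aestronglyMeasurable (by fun_prop))
      (ae_of_all _ fun q => ?_)
    simp only [Function.uncurry, norm_mul, norm_exp_mul_I, norm_exp_neg_mul_I, mul_one, le_refl]

/-- Parseval's formula for smoothed indicator functions. -/
lemma integral_smoothInd_mul {v : ℝ≥0} (hv : v ≠ 0) {a b : ℝ} (hab : a ≤ b) (ν : Measure ℝ)
    [SFinite ν] {g : ℝ → ℝ} (hg : Integrable g ν) :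
    ((∫ x, smoothInd v a b x * g x ∂ν : ℝ) : ℂ) = ((√(2 * Real.pi * v))⁻¹ : ℝ) * ∫ t : ℝ,
      (∫ x : ℝ, Complex.exp ((t : ℂ) * (x : ℂ) * Complex.I) * (g x : ℂ) ∂ν) *
        intervalFourier a b t ∂gaussianReal 0 v⁻¹ := by
  rw [← integral_complex_ofReal]
  simp only [Complex.ofReal_mul, smoothInd_eq_integral hv hab, mul_assoc]
  rw [integral_const_mul]
  congr 1
  simp only [← integral_mul_const, ← mul_assoc]
  rw [integral_integral_swap]
  · refine integral_congr_ae (ae_of_all _ fun t => integral_congr_ae (ae_of_all _ fun x => ?_))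
    simp only
    ring
  · have hcont : Continuous fun q : ℝ × ℝ =>
        Complex.exp ((q.2 : ℂ) * (q.1 : ℂ) * Complex.I) * intervalFourier a b q.2 :=
      Continuous.mul (by fun_prop) ((continuous_intervalFourier a b).comp continuous_snd)
    have hg' : Integrable (fun q : ℝ × ℝ => (g q.1 : ℂ)) (ν.prod (gaussianReal 0 v⁻¹)) :=
      (hg.ofReal (𝕜 := ℂ)).comp_fst _
    refine hg'.bdd_mul (c := |b - a|) hcont.aestronglyMeasurable (ae_of_all _ fun q => ?_)
    rw [norm_mul, norm_exp_mul_I, one_mul]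
    exact norm_intervalFourier_le a b q.2

/-- The smoothed indicator functions distinguish `μ` from the signed density `g` by no more than
an integral of the difference of the Fourier transforms. -/
lemma abs_integral_smoothInd_sub_le {v : ℝ≥0} (hv : v ≠ 0) {a b : ℝ} (hab : a ≤ b) (μ : Measure ℝ)
    [IsProbabilityMeasure μ] {g : ℝ → ℝ} (hg : Integrable g) {Φ : ℝ → ℝ} (hΦ : Integrable Φ)
    (h : ∀ t, ‖charFun μ t - ∫ x : ℝ, Complex.exp ((t : ℂ) * (x : ℂ) * Complex.I) * (g x : ℂ)‖ *
      Real.exp (-v * t ^ 2 / 2) ≤ |t| * Φ t) :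
    |(∫ x, smoothInd v a b x ∂μ) - ∫ x, smoothInd v a b x * g x| ≤ ∫ t, |Φ t| := by
  set γ := gaussianReal 0 v⁻¹ with hγ
  set c := (√(2 * Real.pi * v))⁻¹ with hc
  have hv' : (0 : ℝ) < v := by positivity
  have e1 := integral_smoothInd_mul hv hab μ (g := fun _ => 1) (integrable_const 1)
  have e2 := integral_smoothInd_mul hv hab volume hg
  simp only [mul_one, Complex.ofReal_one] at e1
  simp only [← charFun_apply_real] at e1
  have hbound {f : ℝ → ℂ} (hf : AEStronglyMeasurable f γ) {K : ℝ} (hK : ∀ t, ‖f t‖ ≤ K) :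
      Integrable (fun t => f t * intervalFourier a b t) γ := by
    refine Integrable.of_bound (C := K * |b - a|)
      (hf.mul (continuous_intervalFourier a b).aestronglyMeasurable) (ae_of_all _ fun t => ?_)
    rw [norm_mul]
    exact mul_le_mul (hK t) (norm_intervalFourier_le a b t) (norm_nonneg _)
      ((norm_nonneg _).trans (hK t))
  have hi1 : Integrable (fun t => charFun μ t * intervalFourier a b t) γ :=
    hbound measurable_charFun.aestronglyMeasurable fun t => norm_charFun_le_one t
  have hi2 : Integrable (fun t : ℝ => (∫ x : ℝ, Complex.exp ((t : ℂ) * (x : ℂ) * Complex.I) *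
      (g x : ℂ)) * intervalFourier a b t) γ := by
    refine hbound (K := ∫ x, ‖(g x : ℂ)‖) ?_ fun t => ?_
    · refine (continuous_of_dominated (bound := fun x => ‖(g x : ℂ)‖) (fun t => ?_)
        (fun t => ae_of_all _ fun x => ?_) hg.ofReal.norm
        (ae_of_all _ fun x => by fun_prop)).aestronglyMeasurable
      · exact (integrable_exp_mul_I_mul hg t).aestronglyMeasurable
      · rw [norm_mul, norm_exp_mul_I, one_mul]
    · refine (norm_integral_le_integral_norm _).trans (le_of_eq ?_)
      simp only [norm_mul, norm_exp_mul_I, one_mul]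
  have e3 : (((∫ x, smoothInd v a b x ∂μ) - ∫ x, smoothInd v a b x * g x : ℝ) : ℂ) = c *
      ∫ t, (charFun μ t - ∫ x : ℝ, Complex.exp ((t : ℂ) * (x : ℂ) * Complex.I) * (g x : ℂ)) *
        intervalFourier a b t ∂γ := by
    rw [Complex.ofReal_sub, e1, e2, ← mul_sub, ← integral_sub hi1 hi2]
    simp only [sub_mul]
    rfl
  rw [← Real.norm_eq_abs, ← Complex.norm_real, e3, norm_mul, Complex.norm_real,
    Real.norm_of_nonneg (by positivity), hγ,
    integral_gaussianReal_eq_integral_smul (inv_ne_zero hv)]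
  have hc0 : 0 < c := by positivity
  have hpdf (t : ℝ) : gaussianPDFReal 0 v⁻¹ t =
      c⁻¹ * (2 * Real.pi)⁻¹ * Real.exp (-v * t ^ 2 / 2) := by
    have h3 : (√(2 * Real.pi * (v⁻¹ : ℝ)))⁻¹ = c⁻¹ * (2 * Real.pi)⁻¹ := by
      have h4 : √(2 * Real.pi * (v⁻¹ : ℝ)) = 2 * Real.pi * c := by
        rw [Real.sqrt_eq_iff_mul_self_eq (by positivity) (by positivity), hc]
        have h5 : √(2 * Real.pi * v) ^ 2 = 2 * Real.pi * v := Real.sq_sqrt (by positivity)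
        field_simp
        rw [h5]
      rw [h4, mul_inv, mul_comm]
    rw [gaussianPDFReal, NNReal.coe_inv, h3]
    congr 2
    field_simp
    ring
  have hle : ‖∫ t, gaussianPDFReal 0 v⁻¹ t • ((charFun μ t - ∫ x : ℝ,
      Complex.exp ((t : ℂ) * (x : ℂ) * Complex.I) * (g x : ℂ)) * intervalFourier a b t)‖
      ≤ ∫ t, c⁻¹ * |Φ t| := by
    refine norm_integral_le_of_norm_le (hΦ.abs.const_mul _) (ae_of_all _ fun t => ?_)
    rw [norm_smul, norm_mul, hpdf, Real.norm_of_nonneg (by positivity)]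
    have h6 : |t| * Φ t ≤ |t| * |Φ t| := by gcongr; exact le_abs_self _
    have h7 := (h t).trans h6
    set D := ‖charFun μ t - ∫ x : ℝ, Complex.exp ((t : ℂ) * (x : ℂ) * Complex.I) * (g x : ℂ)‖
    calc c⁻¹ * (2 * Real.pi)⁻¹ * Real.exp (-v * t ^ 2 / 2) * (D * ‖intervalFourier a b t‖)
        = c⁻¹ * (2 * Real.pi)⁻¹ * ((D * Real.exp (-v * t ^ 2 / 2)) * ‖intervalFourier a b t‖) := by
          ring
      _ ≤ c⁻¹ * (2 * Real.pi)⁻¹ * ((|t| * |Φ t|) * ‖intervalFourier a b t‖) := by gcongr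
      _ = c⁻¹ * (2 * Real.pi)⁻¹ * ((|t| * ‖intervalFourier a b t‖) * |Φ t|) := by ring
      _ ≤ c⁻¹ * (2 * Real.pi)⁻¹ * (2 * |Φ t|) := by
          gcongr; exact abs_mul_norm_intervalFourier_le a b t
      _ = c⁻¹ * |Φ t| * Real.pi⁻¹ := by rw [mul_inv]; ring
      _ ≤ c⁻¹ * |Φ t| * 1 := by
          gcongr
          exact inv_le_one_of_one_le₀ (by linarith [Real.pi_gt_three])
      _ = _ := mul_one _
  rw [integral_const_mul] at hle
  calc c * _ ≤ c * (c⁻¹ * ∫ t, |Φ t|) := by gcongr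
    _ = _ := by rw [mul_inv_cancel_left₀ hc0.ne']

lemma integrable_smoothInd_mul (v : ℝ≥0) (hv : v ≠ 0) {a b : ℝ} (hab : a ≤ b) {ν : Measure ℝ}
    {g : ℝ → ℝ} (hg : Integrable g ν) : Integrable (fun x => smoothInd v a b x * g x) ν := by
  have hm : Continuous fun x => smoothInd v a b x := by
    have : Continuous fun x => ((smoothInd v a b x : ℝ) : ℂ) := by
      simp only [smoothInd_eq_integral hv hab]
      refine continuous_const.mul (continuous_of_dominated (bound := fun _ => |b - a|)
        (fun x => ?_) (fun x => ae_of_all _ fun t => ?_) (integrable_const _)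
        (ae_of_all _ fun t => by fun_prop))
      · exact (Continuous.mul (by fun_prop) (continuous_intervalFourier a b)).aestronglyMeasurable
      · rw [norm_mul, norm_exp_mul_I, one_mul]
        exact norm_intervalFourier_le a b t
    exact Complex.continuous_re.comp this
  refine hg.bdd_mul (c := 1) hm.aestronglyMeasurable (ae_of_all _ fun x => ?_)
  rw [Real.norm_of_nonneg (smoothInd_nonneg _ _ _ _)]
  exact smoothInd_le_one _ _ _ _

/-- An Esseen-type smoothing inequality with a Gaussian kernel of variance `v`: the distance between
distribution functions is bounded through the Fourier transforms, up to the effect of a shift by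
`h` and the probability that the Gaussian kernel moves a point by more than `h`. -/
theorem abs_measureReal_Iic_sub_le {v : ℝ≥0} (hv : v ≠ 0) {h : ℝ} (hh : 0 ≤ h) (μ : Measure ℝ)
    [IsProbabilityMeasure μ] {g : ℝ → ℝ} (hg : Integrable g) {B : ℝ} (hgB : ∀ x, |g x| ≤ B)
    {Φ : ℝ → ℝ} (hΦ : Integrable Φ)
    (hF : ∀ t, ‖charFun μ t - ∫ x : ℝ, Complex.exp ((t : ℂ) * (x : ℂ) * Complex.I) * (g x : ℂ)‖ *
      Real.exp (-v * t ^ 2 / 2) ≤ |t| * Φ t) (z : ℝ) :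
    |μ.real (Set.Iic z) - ∫ x in Set.Iic z, g x| ≤ (∫ t, |Φ t|) +
      2 * Real.exp (-h ^ 2 / (2 * v)) * (1 + ∫ x, |g x|) + 4 * h * B := by
  set T := 2 * Real.exp (-h ^ 2 / (2 * v)) with hT
  have hT0 : 0 ≤ T := by positivity
  -- the errors made by smoothing, for a lower end point `a` and an upper end point `b` near `z`
  have hgerr : ∀ a b, a ≤ b → |b - z| ≤ h → |(∫ x, smoothInd v a b x * g x) -
      ∫ x in Set.Iic z, g x| ≤ T * (∫ x, |g x|) + 4 * h * B + ∫ x in Set.Iic (a + h), |g x| := by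
    intro a b hab hb
    have i1 : Integrable fun x => T * |g x| := hg.abs.const_mul _
    have i2 : Integrable ((Set.Icc (z - 2 * h) (z + 2 * h)).indicator fun _ => B) :=
      (integrableOn_const (by simp)).integrable_indicator measurableSet_Icc
    have i3 : Integrable fun x => T * |g x| +
        (Set.Icc (z - 2 * h) (z + 2 * h)).indicator (fun _ => B) x := i1.add i2
    have i4 : Integrable ((Set.Iic (a + h)).indicator fun x => |g x|) :=
      hg.abs.indicator measurableSet_Iic
    have h1 : T * (∫ x, |g x|) + 4 * h * B + ∫ x in Set.Iic (a + h), |g x| =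
        ∫ x, (T * |g x| + (Set.Icc (z - 2 * h) (z + 2 * h)).indicator (fun _ => B) x +
          (Set.Iic (a + h)).indicator (fun x => |g x|) x) := by
      rw [integral_add i3 i4, integral_add i1 i2, integral_const_mul,
        integral_indicator measurableSet_Icc, integral_indicator measurableSet_Iic,
        setIntegral_const, measureReal_def, Real.volume_Icc, ENNReal.toReal_ofReal (by linarith),
        smul_eq_mul]
      ring
    rw [← integral_indicator measurableSet_Iic, ← integral_sub (integrable_smoothInd_mul v hv hab hg)
      (hg.indicator measurableSet_Iic), h1, ← Real.norm_eq_abs]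
    refine norm_integral_le_of_norm_le (i3.add i4) (ae_of_all _ fun x => ?_)
    have h2 := abs_smoothInd_sub_indicator_le hv hh (a := a) hb x
    have h3 : smoothInd v a b x * g x - (Set.Iic z).indicator g x =
        (smoothInd v a b x - (Set.Iic z).indicator 1 x) * g x := by
      by_cases hx : x ∈ Set.Iic z
      · simp [Set.indicator_of_mem hx, sub_mul]
      · simp [Set.indicator_of_notMem hx]
    rw [h3, Real.norm_eq_abs, abs_mul]
    refine (mul_le_mul_of_nonneg_right h2 (abs_nonneg _)).trans ?_
    rw [add_mul, add_mul]
    refine add_le_add (add_le_add le_rfl ?_) ?_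
    · by_cases hx : x ∈ Set.Icc (z - 2 * h) (z + 2 * h)
      · simpa [Set.indicator_of_mem hx] using hgB x
      · simp [Set.indicator_of_notMem hx]
    · by_cases hx : x ∈ Set.Iic (a + h)
      · simp [Set.indicator_of_mem hx]
      · simp [Set.indicator_of_notMem hx]
  have hint (a b : ℝ) (hab : a ≤ b) : Integrable (fun x => smoothInd v a b x) μ := by
    simpa using integrable_smoothInd_mul v hv hab (integrable_const (μ := μ) (1 : ℝ))
  have hintT (a b : ℝ) (hab : a ≤ b) : Integrable (fun x => smoothInd v a b x + T) μ :=
    (hint a b hab).add (integrable_const T)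
  have hind (c : ℝ) : Integrable ((Set.Iic c).indicator (1 : ℝ → ℝ)) μ :=
    (integrable_const (1 : ℝ)).indicator measurableSet_Iic
  have hup : ∀ a, a ≤ z → μ.real (Set.Iic z) ≤ (∫ x, smoothInd v a (z + h) x ∂μ) + T +
      μ.real (Set.Iic (a + h)) := by
    intro a ha
    have e : (∫ x, smoothInd v a (z + h) x ∂μ) + T + μ.real (Set.Iic (a + h)) =
        ∫ x, (smoothInd v a (z + h) x + T + (Set.Iic (a + h)).indicator (1 : ℝ → ℝ) x) ∂μ := by
      rw [integral_add (hintT a (z + h) (by linarith)) (hind _),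
        integral_add (hint a (z + h) (by linarith)) (integrable_const _),
        integral_indicator_one measurableSet_Iic]
      simp
    rw [e, ← integral_indicator_one measurableSet_Iic]
    refine integral_mono (hind _) ((hintT a (z + h) (by linarith)).add (hind _)) fun x => ?_
    have h0 := smoothInd_nonneg v a (z + h) x
    have hi : 0 ≤ (Set.Iic (a + h)).indicator (1 : ℝ → ℝ) x :=
      Set.indicator_nonneg (fun _ _ => zero_le_one) x
    by_cases hx : x ∈ Set.Iic z
    · rw [Set.indicator_of_mem hx, Pi.one_apply]
      by_cases hxa : x ∈ Set.Iic (a + h)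
      · rw [Set.indicator_of_mem hxa, Pi.one_apply]
        linarith
      · have := one_sub_le_smoothInd hv hh (not_le.1 hxa) (b := z + h) (by
          have : x ≤ z := hx
          linarith)
        linarith
    · rw [Set.indicator_of_notMem hx]
      linarith
  have hlow : ∀ a, a ≤ z - h → (∫ x, smoothInd v a (z - h) x ∂μ) ≤ μ.real (Set.Iic z) + T := by
    intro a ha
    have e : μ.real (Set.Iic z) + T = ∫ x, ((Set.Iic z).indicator (1 : ℝ → ℝ) x + T) ∂μ := by
      rw [integral_add (hind _) (integrable_const _), integral_indicator_one measurableSet_Iic]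
      simp
    rw [e]
    refine integral_mono (hint _ _ ha) ((hind _).add (integrable_const _)) fun x => ?_
    by_cases hx : x ∈ Set.Iic z
    · rw [Set.indicator_of_mem hx, Pi.one_apply]
      linarith [smoothInd_le_one v a (z - h) x]
    · rw [Set.indicator_of_notMem hx]
      have : z < x := not_le.1 hx
      linarith [smoothInd_le_of_add_le hv hh (a := a) (b := z - h) (x := x) (by linarith)]
  have hall : ∀ a, a ≤ z - h → |μ.real (Set.Iic z) - ∫ x in Set.Iic z, g x| ≤ (∫ t, |Φ t|) +
      T * (1 + ∫ x, |g x|) + 4 * h * B + ((∫ _ in Set.Iic (a + h), (1 : ℝ) ∂μ) +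
        ∫ x in Set.Iic (a + h), |g x|) := by
    intro a ha
    have e : ∫ _ in Set.Iic (a + h), (1 : ℝ) ∂μ = μ.real (Set.Iic (a + h)) := by simp
    have hma : 0 ≤ μ.real (Set.Iic (a + h)) := measureReal_nonneg
    have u1 := abs_le.1 (hgerr a (z + h) (by linarith) (by simp [abs_of_nonneg hh]))
    have u2 := abs_le.1 (hgerr a (z - h) ha (by simp [abs_of_nonneg hh]))
    have u3 := abs_le.1 (abs_integral_smoothInd_sub_le hv (by linarith : a ≤ z + h) μ hg hΦ hF)
    have u4 := abs_le.1 (abs_integral_smoothInd_sub_le hv ha μ hg hΦ hF)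
    rw [e, abs_le]
    constructor
    · linarith [hlow a ha, u2.1, u4.1]
    · linarith [hup a (by linarith), u1.2, u3.2]
  have hshift : Tendsto (fun a : ℝ => a + h) atBot atBot := tendsto_atBot_add_const_right _ _ tendsto_id
  have hlim := ((tendsto_setIntegral_Iic_atBot (integrable_const (μ := μ) (1 : ℝ))).comp hshift).add
    ((tendsto_setIntegral_Iic_atBot hg.abs).comp hshift)
  have hlim2 := hlim.const_add ((∫ t, |Φ t|) + T * (1 + ∫ x, |g x|) + 4 * h * B)
  rw [add_zero, add_zero] at hlim2
  exact ge_of_tendsto hlim2 ((eventually_le_atBot (z - h)).mono hall)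

/-! ### Characteristic functions away from the origin -/

lemma norm_one_add_exp_le {θ : ℝ} (hθ : |θ| ≤ Real.pi) :
    ‖1 + Complex.exp (θ * Complex.I)‖ ≤ 2 - θ ^ 2 / Real.pi ^ 2 := by
  have hpi := Real.pi_pos
  have h1 : θ ^ 2 / Real.pi ^ 2 ≤ 1 := by
    rw [div_le_one (by positivity)]
    exact sq_le_sq' (abs_le.1 hθ).1 (abs_le.1 hθ).2
  have h2 : ‖1 + Complex.exp (θ * Complex.I)‖ ^ 2 = 2 + 2 * Real.cos θ := by
    rw [Complex.sq_norm, Complex.normSq_apply]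
    simp only [Complex.add_re, Complex.add_im, Complex.one_re, Complex.one_im,
      Complex.exp_ofReal_mul_I_re, Complex.exp_ofReal_mul_I_im]
    nlinarith [Real.sin_sq_add_cos_sq θ]
  have h3 := Real.cos_le_one_sub_mul_cos_sq hθ
  have h4 : 2 / Real.pi ^ 2 * θ ^ 2 = 2 * (θ ^ 2 / Real.pi ^ 2) := by ring
  refine abs_le_of_sq_le_sq' ?_ (by linarith) |>.2
  rw [h2]
  nlinarith [sq_nonneg (θ ^ 2 / Real.pi ^ 2)]

lemma exists_abs_sub_le_pi (x : ℝ) : ∃ k : ℤ, |x - 2 * Real.pi * k| ≤ Real.pi := by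
  have hpi := Real.pi_pos
  refine ⟨round (x / (2 * Real.pi)), ?_⟩
  have h1 := abs_sub_round (x / (2 * Real.pi))
  have h2 : x - 2 * Real.pi * (round (x / (2 * Real.pi)) : ℤ) =
      2 * Real.pi * (x / (2 * Real.pi) - (round (x / (2 * Real.pi)) : ℤ)) := by
    field_simp
  rw [h2, abs_mul, abs_of_pos (by positivity)]
  nlinarith

/-- Two unit vectors of the average that defines the characteristic function already produce a
cancellation quadratic in their angular distance. -/
lemma exists_norm_charFun_atomicLaw_le {d : ℕ} [NeZero d] {a p : Fin (d + 1) → ℝ}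
    (h : IsCenteredParam a p) : ∃ c : ℝ, 0 < c ∧ ∀ s : ℝ,
      ‖charFun (atomicLaw a p) s‖ ≤ Real.exp (-c * resonanceDist a s ^ 2) := by
  have hpi := Real.pi_pos
  obtain ⟨i₀, hi₀⟩ := Finite.exists_min p
  set q := p i₀ with hq
  have hq0 : 0 < q := h.1 i₀
  refine ⟨q / Real.pi ^ 2, by positivity, fun s => ?_⟩
  obtain ⟨j, hj⟩ := exists_eq_ciSup_of_finite (f := fun j : Fin d =>
    Metric.infDist ((a j.succ - a 0) * s) (Set.range fun k : ℤ => 2 * Real.pi * (k : ℝ)))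
  obtain ⟨k, hk⟩ := exists_abs_sub_le_pi ((a j.succ - a 0) * s)
  set θ := (a j.succ - a 0) * s - 2 * Real.pi * k with hθ
  have hres : resonanceDist a s ≤ |θ| := by
    rw [resonanceDist, ← hj]; exact infDist_le_abs_sub _ k
  have hres0 : 0 ≤ resonanceDist a s := latticeDist_nonneg _ _
  have hne : (0 : Fin (d + 1)) ≠ j.succ := (Fin.succ_ne_zero j).symm
  let u : Fin (d + 1) → ℂ := fun i => Complex.exp (s * a i * Complex.I)
  have hu (i) : ‖u i‖ = 1 := norm_exp_mul_I s (a i)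
  let w : Fin (d + 1) → ℝ := fun i => p i - (if i = 0 then q else 0) - if i = j.succ then q else 0
  have hw (i) : 0 ≤ w i := by
    have := hi₀ i
    have := (h.1 i).le
    simp only [w]
    split_ifs with h1 h2 h2
    · exact absurd (h1.symm.trans h2) hne
    all_goals linarith
  have hwsum : ∑ i, w i = 1 - 2 * q := by
    simp only [w, Finset.sum_sub_distrib, h.2.1, Finset.sum_ite_eq', Finset.mem_univ, if_true]
    ring
  have hpair : u 0 + u j.succ = u 0 * (1 + Complex.exp (θ * Complex.I)) := by
    have e : Complex.exp (θ * Complex.I) = Complex.exp (((a j.succ - a 0) * s : ℝ) * Complex.I) := by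
      rw [hθ, show (((a j.succ - a 0) * s - 2 * Real.pi * k : ℝ) : ℂ) * Complex.I =
        (((a j.succ - a 0) * s : ℝ) : ℂ) * Complex.I - k * (2 * Real.pi * Complex.I) by
          push_cast; ring, Complex.exp_sub, Complex.exp_int_mul_two_pi_mul_I, div_one]
    rw [e, mul_add, mul_one, ← Complex.exp_add]
    congr 1
    simp only [u]
    congr 1
    push_cast
    ring
  have hsplit : charFun (atomicLaw a p) s = ∑ i, (w i : ℂ) * u i + q * (u 0 + u j.succ) := by
    rw [charFun_atomicLaw h.1]
    have : ∀ i, (w i : ℂ) * u i = p i * u i - (if i = 0 then q * u i else 0) -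
        if i = j.succ then q * u i else 0 := by
      intro i
      simp only [w]
      push_cast
      split_ifs <;> simp [sub_mul]
    simp only [this, Finset.sum_sub_distrib, Finset.sum_ite_eq', Finset.mem_univ, if_true]
    simp only [u]
    ring
  have hx : θ ^ 2 / Real.pi ^ 2 * q ≥ q / Real.pi ^ 2 * resonanceDist a s ^ 2 := by
    rw [← sq_abs θ]
    have : resonanceDist a s ^ 2 ≤ |θ| ^ 2 := by gcongr
    calc q / Real.pi ^ 2 * resonanceDist a s ^ 2 ≤ q / Real.pi ^ 2 * |θ| ^ 2 := by gcongr
      _ = _ := by ring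
  calc ‖charFun (atomicLaw a p) s‖ ≤ ∑ i, w i + q * (2 - θ ^ 2 / Real.pi ^ 2) := by
        rw [hsplit]
        refine (norm_add_le _ _).trans (add_le_add ((norm_sum_le _ _).trans
          (Finset.sum_le_sum fun i _ => ?_)) ?_)
        · rw [norm_mul, hu, mul_one, Complex.norm_real, Real.norm_of_nonneg (hw i)]
        · rw [hpair, norm_mul, norm_mul, hu, one_mul, Complex.norm_real, Real.norm_of_nonneg hq0.le]
          gcongr
          exact norm_one_add_exp_le hk
    _ ≤ -(q / Real.pi ^ 2) * resonanceDist a s ^ 2 + 1 := by rw [hwsum]; linarith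
    _ ≤ _ := Real.add_one_le_exp _

/-! ### The law of the normalized sum -/

/-- The law of `S_n / (σ √n)`. -/
def normalizedSumLaw (μ : Measure ℝ) (n : ℕ) : Measure ℝ :=
  (Measure.pi fun _ : Fin n => μ).map fun x => (∑ j, x j) / (stdDev μ * √(n : ℝ))

lemma normalizedSumCDF_eq (μ : Measure ℝ) (n : ℕ) (z : ℝ) :
    normalizedSumCDF μ n z = (normalizedSumLaw μ n).real (Set.Iic z) := by
  rw [normalizedSumLaw, map_measureReal_apply (by fun_prop) measurableSet_Iic]
  rfl

lemma isProbabilityMeasure_normalizedSumLaw (μ : Measure ℝ) [IsProbabilityMeasure μ] (n : ℕ) :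
    IsProbabilityMeasure (normalizedSumLaw μ n) :=
  Measure.isProbabilityMeasure_map (by fun_prop)

lemma charFun_normalizedSumLaw (μ : Measure ℝ) [IsProbabilityMeasure μ] (n : ℕ) (t : ℝ) :
    charFun (normalizedSumLaw μ n) t = charFun μ (t / (stdDev μ * √(n : ℝ))) ^ n := by
  have h1 : normalizedSumLaw μ n = ((Measure.pi fun _ : Fin n => μ).map fun x => ∑ j, x j).map
      fun y => (stdDev μ * √(n : ℝ))⁻¹ * y := by
    rw [Measure.map_map (by fun_prop) (by fun_prop), normalizedSumLaw]
    congr 1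
    ext x
    simp [div_eq_inv_mul]
  rw [h1, charFun_map_mul, charFun_map_sum_pi_eq_prod]
  simp [div_eq_inv_mul]

/-! ### The error of the Edgeworth expansion under a Diophantine condition -/

lemma tendsto_rpow_mul_exp_neg_rpow (κ : ℝ) {c η : ℝ} (hc : 0 < c) (hη : 0 < η) :
    Tendsto (fun n : ℕ => (n : ℝ) ^ κ * Real.exp (-c * (n : ℝ) ^ η)) atTop (𝓝 0) := by
  have h1 := (tendsto_rpow_mul_exp_neg_mul_atTop_nhds_zero (κ / η) c hc).comp
    ((tendsto_rpow_atTop hη).comp tendsto_natCast_atTop_atTop)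
  refine h1.congr fun n => ?_
  simp only [Function.comp_apply]
  rw [← Real.rpow_mul (Nat.cast_nonneg n), mul_div_cancel₀ _ hη.ne']

/-- Middle frequencies: beyond `δ √n` and below `n ^ κ` the Diophantine condition makes
the characteristic function of the normalized sum stretched-exponentially small, when the exponent
`1 - 2 β (κ - 1 / 2)` is positive. -/
lemma exists_norm_charFun_pow_le {d : ℕ} [NeZero d] {a p : Fin (d + 1) → ℝ} {β : ℝ}
    (h : IsCenteredParam a p) (hβ : 0 ≤ β) (hdio : IsDiophantine β a) {σ δ : ℝ} (hσ : 0 < σ)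
    (hδ : 0 < δ) : ∃ c : ℝ, 0 < c ∧ ∀ (n : ℕ) (κ t : ℝ), 0 < n → δ * √(n : ℝ) ≤ |t| →
      |t| ≤ (n : ℝ) ^ κ → ‖charFun (atomicLaw a p) (t / (σ * √(n : ℝ))) ^ n‖ ≤
        Real.exp (-c * (n : ℝ) ^ (1 - 2 * β * (κ - 1 / 2))) := by
  obtain ⟨c, hc, hchar⟩ := exists_norm_charFun_atomicLaw_le h
  obtain ⟨K₀, hK₀, hd₀⟩ := hdio
  obtain ⟨K, hK, hd⟩ := exists_le_latticeDist_of_large hK₀ hd₀ (div_pos hδ hσ)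
  refine ⟨c * (K * σ ^ β) ^ 2, by positivity, fun n κ t hn ht1 ht2 => ?_⟩
  have hn' : (0 : ℝ) < n := by exact_mod_cast hn
  have hsq : 0 < √(n : ℝ) := Real.sqrt_pos.2 hn'
  set s := t / (σ * √(n : ℝ)) with hs
  have hsabs : |s| = |t| / √(n : ℝ) / σ := by
    rw [hs, abs_div, abs_of_pos (by positivity : 0 < σ * √(n : ℝ))]; field_simp
  have hs1 : δ / σ ≤ |s| := by
    rw [hsabs]; gcongr; rwa [le_div_iff₀ hsq]
  have hs0 : 0 < |s| := (div_pos hδ hσ).trans_le hs1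
  have hs2 : |s| ^ β ≤ (n : ℝ) ^ (β * (κ - 1 / 2)) / σ ^ β := by
    rw [mul_comm β, Real.rpow_mul hn'.le, ← Real.div_rpow (by positivity) hσ.le]
    refine Real.rpow_le_rpow hs0.le ?_ hβ
    rw [hsabs, Real.rpow_sub hn', ← Real.sqrt_eq_rpow]
    gcongr
  have hlow : K * σ ^ β * (n : ℝ) ^ (-(β * (κ - 1 / 2))) ≤ resonanceDist a s := by
    refine le_trans ?_ (hd s hs1)
    rw [Real.rpow_neg hn'.le, le_div_iff₀ (by positivity)]
    calc _ ≤ K * σ ^ β * ((n : ℝ) ^ (β * (κ - 1 / 2)))⁻¹ *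
          ((n : ℝ) ^ (β * (κ - 1 / 2)) / σ ^ β) := by gcongr
      _ = K := by field_simp
  rw [norm_pow]
  calc ‖charFun (atomicLaw a p) s‖ ^ n ≤ Real.exp (-c * resonanceDist a s ^ 2) ^ n := by
        gcongr; exact hchar s
    _ = Real.exp (-(c * (n * resonanceDist a s ^ 2))) := by rw [← Real.exp_nat_mul]; ring_nf
    _ ≤ Real.exp (-(c * (n * (K * σ ^ β * (n : ℝ) ^ (-(β * (κ - 1 / 2)))) ^ 2))) := by gcongr
    _ = _ := by
        have e : (n : ℝ) ^ (1 - 2 * β * (κ - 1 / 2)) =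
            n * ((n : ℝ) ^ (-(β * (κ - 1 / 2)))) ^ 2 := by
          rw [← Real.rpow_mul_natCast hn'.le]
          nth_rewrite 2 [← Real.rpow_one (n : ℝ)]
          rw [← Real.rpow_add hn']
          congr 1; push_cast; ring
        rw [e]; ring_nf

/-- Domination of the difference of two Fourier transforms, damped by a Gaussian kernel: a Taylor
bound up to `δ N`, decay of both transforms up to `T`, and decay of the kernel beyond `T`. -/
lemma norm_sub_mul_exp_le {f g : ℝ → ℂ} {C δ B N T τ ρ : ℝ} {r : ℕ} (hC : 0 ≤ C) (hδ : 0 < δ)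
    (hB : 0 ≤ B) (hN : 1 ≤ N) (hT : 0 ≤ T) (hρ : 0 ≤ ρ)
    (hlow : ∀ t, |t| ≤ δ * N →
      ‖f t - g t‖ ≤ C * (|t| / N) ^ (r + 1) * Real.exp (-(1 / 4) * t ^ 2))
    (hhigh : ∀ t, δ * N ≤ |t| → |t| ≤ T → ‖f t‖ ≤ ρ) (hf : ∀ t, ‖f t‖ ≤ 1)
    (hg : ∀ t, ‖g t‖ ≤ B * Real.exp (-(1 / 4) * t ^ 2)) (t : ℝ) :
    ‖f t - g t‖ * Real.exp (-τ ^ 2 * t ^ 2 / 2) ≤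
      |t| * (C * (N ^ (r + 1))⁻¹ * (|t| ^ r * Real.exp (-(1 / 4) * t ^ 2)) +
        (1 + B) / δ * (ρ + Real.exp (-(1 / 4) * (τ * T) ^ 2) + Real.exp (-(δ ^ 2 / 4) * N ^ 2)) *
          Real.exp (-(τ ^ 2 / 4) * t ^ 2)) := by
  have hτt : 0 ≤ τ ^ 2 * t ^ 2 := by positivity
  have hx : 0 < Real.exp (-(1 / 4) * (τ * T) ^ 2) := Real.exp_pos _
  have hy : 0 < Real.exp (-(δ ^ 2 / 4) * N ^ 2) := Real.exp_pos _
  rcases le_or_gt |t| (δ * N) with ht | ht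
  · have h1 : Real.exp (-τ ^ 2 * t ^ 2 / 2) ≤ 1 := Real.exp_le_one_iff.2 (by linarith)
    calc ‖f t - g t‖ * Real.exp (-τ ^ 2 * t ^ 2 / 2)
        ≤ C * (|t| / N) ^ (r + 1) * Real.exp (-(1 / 4) * t ^ 2) * 1 :=
          mul_le_mul (hlow t ht) h1 (Real.exp_pos _).le (by positivity)
      _ = |t| * (C * (N ^ (r + 1))⁻¹ * (|t| ^ r * Real.exp (-(1 / 4) * t ^ 2))) := by
          rw [div_pow]; ring
      _ ≤ _ := mul_le_mul_of_nonneg_left (le_add_of_nonneg_right (by positivity)) (abs_nonneg t)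
  have htδ : 1 ≤ |t| / δ := by
    rw [le_div_iff₀ hδ]; nlinarith
  have ht2 : δ ^ 2 * N ^ 2 ≤ t ^ 2 := by
    rw [← sq_abs t, ← mul_pow]
    exact pow_le_pow_left₀ (by positivity) ht.le 2
  set E := Real.exp (-(τ ^ 2 / 4) * t ^ 2) with hE
  have hE0 : 0 < E := Real.exp_pos _
  have hE1 : E ≤ 1 := Real.exp_le_one_iff.2 (by linarith)
  have hexp : Real.exp (-τ ^ 2 * t ^ 2 / 2) = E * E := by
    rw [hE, ← Real.exp_add]; ring_nf
  set S := ρ + Real.exp (-(1 / 4) * (τ * T) ^ 2) + Real.exp (-(δ ^ 2 / 4) * N ^ 2) with hS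
  have hS0 : 0 < S := by positivity
  have hfρ : ‖f t‖ * E ≤ S := by
    rcases le_or_gt |t| T with ht3 | ht3
    · have := mul_le_mul (hhigh t ht.le ht3) hE1 hE0.le hρ
      linarith
    · have h2 : E ≤ Real.exp (-(1 / 4) * (τ * T) ^ 2) := by
        rw [hE, Real.exp_le_exp, mul_pow, ← sq_abs t]
        have : τ ^ 2 * T ^ 2 ≤ τ ^ 2 * |t| ^ 2 := by gcongr
        linarith
      have := mul_le_mul (hf t) h2 hE0.le zero_le_one
      linarith
  have hgρ : ‖g t‖ ≤ B * S := by
    refine (hg t).trans (mul_le_mul_of_nonneg_left ?_ hB)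
    have : Real.exp (-(1 / 4) * t ^ 2) ≤ Real.exp (-(δ ^ 2 / 4) * N ^ 2) := by
      rw [Real.exp_le_exp]; linarith
    linarith
  have hsum : ‖f t - g t‖ * E ≤ (1 + B) * S := by
    have h3 : ‖f t - g t‖ * E ≤ (‖f t‖ + ‖g t‖) * E :=
      mul_le_mul_of_nonneg_right (norm_sub_le _ _) hE0.le
    have h4 : ‖g t‖ * E ≤ B * S * 1 := mul_le_mul hgρ hE1 hE0.le (by positivity)
    linarith
  calc ‖f t - g t‖ * Real.exp (-τ ^ 2 * t ^ 2 / 2) = (‖f t - g t‖ * E) * E := by rw [hexp]; ring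
    _ ≤ ((1 + B) * S) * E := mul_le_mul_of_nonneg_right hsum hE0.le
    _ ≤ |t| / δ * (((1 + B) * S) * E) := le_mul_of_one_le_left (by positivity) htδ
    _ = |t| * ((1 + B) / δ * S * E) := by ring
    _ ≤ _ := mul_le_mul_of_nonneg_left (le_add_of_nonneg_left (by positivity)) (abs_nonneg t)

lemma integrable_abs_pow_mul_exp (r : ℕ) :
    Integrable fun t : ℝ => |t| ^ r * Real.exp (-(1 / 4) * t ^ 2) := by
  have := (integrable_rpow_mul_exp_neg_mul_sq (b := 1 / 4) (by norm_num) (s := r)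
    (by have : (0 : ℝ) ≤ r := Nat.cast_nonneg r
        linarith)).abs
  simpa [abs_mul, abs_pow] using this

/-- The quantitative form of the expansion, for a smoothing kernel of standard deviation `τ`, a
shift `η`, and a frequency cut-off `n ^ κ`. -/
lemma exists_edgeworth_error_bound {d : ℕ} [NeZero d] {a p : Fin (d + 1) → ℝ} {β : ℝ}
    (h : IsCenteredParam a p) (hne : ∃ i j, a i ≠ a j) (hβ : 0 ≤ β) (hdio : IsDiophantine β a)
    {r : ℕ} {P : Fin r → Polynomial ℝ} (hP : IsEdgeworthSeries (atomicLaw a p) P) :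
    ∃ A₁ A₂ A₃ A₄ c : ℝ, 0 < c ∧
      ∀ (κ τ η : ℝ) (n : ℕ), 0 < n → 0 < τ → 0 < η → ∀ z : ℝ,
        |normalizedSumCDF (atomicLaw a p) n z - edgeworthExpr P n z| ≤
          A₁ * (√(n : ℝ) ^ (r + 1))⁻¹ +
          A₂ * (Real.exp (-c * (n : ℝ) ^ (1 - 2 * β * (κ - 1 / 2))) +
            Real.exp (-(1 / 4) * (τ * (n : ℝ) ^ κ) ^ 2) + Real.exp (-c * n)) * τ⁻¹ +
          A₃ * Real.exp (-η ^ 2 / (2 * τ ^ 2)) + A₄ * η := by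
  have := isProbabilityMeasure_atomicLaw h
  have hσ : 0 < stdDev (atomicLaw a p) := by
    rw [stdDev_atomicLaw h]; exact Real.sqrt_pos.2 (sum_mul_sq_pos h hne)
  obtain ⟨C, δ, hC, hδ, hlowfreq⟩ := hP.low_frequency h hne
  obtain ⟨c₁, hc₁, hhigh⟩ := exists_norm_charFun_pow_le h hβ hdio hσ hδ
  obtain ⟨B₁, hB₁, hdens⟩ := exists_abs_edgeworthDensity_le P
  obtain ⟨B₂, hB₂, hfour⟩ := exists_norm_edgeworthFourier_le P
  have hgauss (b : ℝ) (hb : 0 < b) : Integrable fun t : ℝ => Real.exp (-b * t ^ 2) :=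
    integrable_exp_neg_mul_sq hb
  refine ⟨C * ∫ t : ℝ, |t| ^ r * Real.exp (-(1 / 4) * t ^ 2), (1 + B₂) / δ * √(Real.pi / (1 / 4)),
    2 * (1 + ∫ x : ℝ, B₁ * Real.exp (-(1 / 4) * x ^ 2)), 4 * B₁, min c₁ (δ ^ 2 / 4), by positivity,
    fun κ τ η n hn hτ hη z => ?_⟩
  have hn' : (0 : ℝ) < n := by exact_mod_cast hn
  have := isProbabilityMeasure_normalizedSumLaw (atomicLaw a p) n
  obtain ⟨v, hv⟩ : ∃ v : NNReal, (v : ℝ) = τ ^ 2 := ⟨⟨τ ^ 2, by positivity⟩, rfl⟩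
  have hv0 : v ≠ 0 := by
    rintro rfl
    exact (pow_ne_zero 2 hτ.ne') hv.symm
  have hF := norm_sub_mul_exp_le (f := charFun (normalizedSumLaw (atomicLaw a p) n))
    (g := edgeworthFourier P n) (N := √(n : ℝ)) (T := (n : ℝ) ^ κ) (τ := τ) hC.le hδ hB₂.le
    (by rw [Real.one_le_sqrt]; exact_mod_cast hn) (by positivity) (Real.exp_pos _).le
    (fun t ht => by rw [charFun_normalizedSumLaw]; exact hlowfreq n hn t ht)
    (fun t ht1 ht2 => by rw [charFun_normalizedSumLaw]; exact hhigh n κ t hn ht1 ht2)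
    (fun t => norm_charFun_le_one t) (hfour n hn)
  rw [Real.sq_sqrt hn'.le] at hF
  obtain ⟨ρ, hρ⟩ : ∃ ρ, ρ = Real.exp (-c₁ * (n : ℝ) ^ (1 - 2 * β * (κ - 1 / 2))) +
    Real.exp (-(1 / 4) * (τ * (n : ℝ) ^ κ) ^ 2) + Real.exp (-(δ ^ 2 / 4) * n) := ⟨_, rfl⟩
  have hρ0 : 0 < ρ := by rw [hρ]; positivity
  rw [← hρ] at hF
  have hI₁ := (integrable_abs_pow_mul_exp r).const_mul (C * (√(n : ℝ) ^ (r + 1))⁻¹)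
  have hI₂ := (hgauss (τ ^ 2 / 4) (by positivity)).const_mul ((1 + B₂) / δ * ρ)
  have hΦval : ∫ t : ℝ, |C * (√(n : ℝ) ^ (r + 1))⁻¹ * (|t| ^ r * Real.exp (-(1 / 4) * t ^ 2)) +
      (1 + B₂) / δ * ρ * Real.exp (-(τ ^ 2 / 4) * t ^ 2)| =
      C * (√(n : ℝ) ^ (r + 1))⁻¹ * (∫ t : ℝ, |t| ^ r * Real.exp (-(1 / 4) * t ^ 2)) +
        (1 + B₂) / δ * ρ * (√(Real.pi / (1 / 4)) * τ⁻¹) := by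
    rw [← integral_const_mul, show √(Real.pi / (1 / 4)) * τ⁻¹ = √(Real.pi / (τ ^ 2 / 4)) by
      rw [show Real.pi / (τ ^ 2 / 4) = Real.pi / (1 / 4) / τ ^ 2 by field_simp,
        Real.sqrt_div (by positivity : 0 ≤ Real.pi / (1 / 4)) (τ ^ 2), Real.sqrt_sq hτ.le, div_eq_mul_inv _ τ],
      ← integral_gaussian, ← integral_const_mul, ← integral_add hI₁ hI₂]
    refine integral_congr_ae (ae_of_all _ fun t => abs_of_nonneg ?_)
    positivity
  have hg := integrable_gaussMul (edgeworthFactor P n)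
  have hgB : ∀ x, |gaussMul (edgeworthFactor P n) x| ≤ B₁ := fun x =>
    (hdens n hn x).trans (mul_le_of_le_one_right hB₁.le
      (Real.exp_le_one_iff.2 (by nlinarith [sq_nonneg x])))
  have hgG := integral_mono hg.abs ((hgauss (1 / 4) (by norm_num)).const_mul B₁) (hdens n hn)
  have hmain := abs_measureReal_Iic_sub_le hv0 hη.le (normalizedSumLaw (atomicLaw a p) n) hg hgB
    (hI₁.add hI₂) (fun t => by
      have := hF t
      rw [edgeworthFourier_eq_gaussTransform] at this
      rw [hv]
      exact this) z
  rw [← normalizedSumCDF_eq, ← edgeworthExpr_eq_integral] at hmain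
  have hmain2 := hmain.trans_eq (congrArg (fun x => x + _ + _) hΦval)
  rw [hv] at hmain2
  have hρle : ρ ≤ Real.exp (-min c₁ (δ ^ 2 / 4) * (n : ℝ) ^ (1 - 2 * β * (κ - 1 / 2))) +
      Real.exp (-(1 / 4) * (τ * (n : ℝ) ^ κ) ^ 2) + Real.exp (-min c₁ (δ ^ 2 / 4) * n) := by
    rw [hρ]
    gcongr
    · exact min_le_left _ _
    · exact min_le_right _ _
  have hE0 := Real.exp_pos (-η ^ 2 / (2 * τ ^ 2))
  have t1 := mul_le_mul_of_nonneg_left hρle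
    (by positivity : 0 ≤ (1 + B₂) / δ * (√(Real.pi / (1 / 4)) * τ⁻¹))
  have t2 := mul_le_mul_of_nonneg_left hgG (by positivity : 0 ≤ 2 * Real.exp (-η ^ 2 / (2 * τ ^ 2)))
  linarith

/-- The exponents `1 / (d - 1) ≤ β` of the Diophantine condition keep `R` below `d / 2`, the order
of the first omitted term of the expansion. -/
lemma lt_half_of_isDiophantine {d : ℕ} (hd : 2 ≤ d) {a : Fin (d + 1) → ℝ} {β R : ℝ}
    (hdio : IsDiophantine β a) (hR : 2 * (R - 1 / 2) * β < 1) : 0 < β ∧ R < d / 2 := by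
  have : Nonempty (Fin d) := ⟨⟨0, by omega⟩⟩
  have h1 := (isDiophantine_iff_freq.1 hdio).one_le_mul
  rw [Fintype.card_fin] at h1
  have hd' : (2 : ℝ) ≤ d := by exact_mod_cast hd
  have hβ : 0 < β := by
    by_contra! hβ
    nlinarith
  refine ⟨hβ, ?_⟩
  by_contra! hle
  nlinarith

lemma IsDiophantine.exists_ne {d : ℕ} (hd : 2 ≤ d) {a : Fin (d + 1) → ℝ} {β : ℝ}
    (hdio : IsDiophantine β a) : ∃ i j, a i ≠ a j := by
  have : Nonempty (Fin d) := ⟨⟨0, by omega⟩⟩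
  obtain ⟨j, hj⟩ := (isDiophantine_iff_freq.1 hdio).exists_ne_zero
  exact ⟨j.succ, 0, sub_ne_zero.1 hj⟩

theorem uniformEdgeworthError_of_isDiophantine {d : ℕ} (hd : 2 ≤ d) {a p : Fin (d + 1) → ℝ}
    {β R : ℝ} (h : IsCenteredParam a p) (hdio : IsDiophantine β a) (hR : 2 * (R - 1 / 2) * β < 1)
    {P : Fin (d - 1) → Polynomial ℝ} (hP : IsEdgeworthSeries (atomicLaw a p) P) :
    UniformEdgeworthError (atomicLaw a p) P R := by
  have : NeZero d := ⟨by omega⟩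
  obtain ⟨hβ, hRd⟩ := lt_half_of_isDiophantine hd hdio hR
  obtain ⟨A₁, A₂, A₃, A₄, c, hc, hbound⟩ :=
    exists_edgeworth_error_bound h (hdio.exists_ne hd) hβ.le hdio hP
  obtain ⟨e, he0, he⟩ : ∃ e : ℝ, 0 < e ∧ 0 < 1 - 2 * β * (R + 3 * e - 1 / 2) := by
    refine ⟨(1 - 2 * (R - 1 / 2) * β) / (12 * β), by
      have : 0 < 1 - 2 * (R - 1 / 2) * β := by linarith
      positivity, ?_⟩
    have : 2 * β * (R + 3 * ((1 - 2 * (R - 1 / 2) * β) / (12 * β)) - 1 / 2) =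
        2 * (R - 1 / 2) * β + (1 - 2 * (R - 1 / 2) * β) / 2 := by field_simp; ring
    rw [this]
    linarith
  -- The kernel has standard deviation `n ^ (-(R + 2 e))`, so that its tails beyond `n ^ (-(R + e))`
  -- and its Fourier transform beyond `n ^ (R + 3 e)` are negligible.
  have hlim : Tendsto (fun n : ℕ => A₁ * (n : ℝ) ^ (-((d : ℝ) / 2 - R)) +
      A₂ * ((n : ℝ) ^ (2 * R + 2 * e) * Real.exp (-c * (n : ℝ) ^ (1 - 2 * β * (R + 3 * e - 1 / 2))) +
        (n : ℝ) ^ (2 * R + 2 * e) * Real.exp (-(1 / 4) * (n : ℝ) ^ (2 * e)) +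
        (n : ℝ) ^ (2 * R + 2 * e) * Real.exp (-c * (n : ℝ) ^ (1 : ℝ))) +
      A₃ * ((n : ℝ) ^ R * Real.exp (-(1 / 2) * (n : ℝ) ^ (2 * e))) + A₄ * (n : ℝ) ^ (-e))
      atTop (𝓝 0) := by
    have hneg (x : ℝ) (hx : 0 < x) : Tendsto (fun n : ℕ => (n : ℝ) ^ (-x)) atTop (𝓝 0) :=
      (tendsto_rpow_neg_atTop hx).comp tendsto_natCast_atTop_atTop
    have h1 := ((((hneg _ (sub_pos.2 hRd)).const_mul A₁).add
      ((((tendsto_rpow_mul_exp_neg_rpow (2 * R + 2 * e) hc he).add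
      (tendsto_rpow_mul_exp_neg_rpow (2 * R + 2 * e) (c := 1 / 4) (by norm_num)
        (by positivity : 0 < 2 * e))).add
      (tendsto_rpow_mul_exp_neg_rpow (2 * R + 2 * e) hc one_pos)).const_mul A₂)).add
      ((tendsto_rpow_mul_exp_neg_rpow R (c := 1 / 2) (by norm_num)
        (by positivity : 0 < 2 * e)).const_mul A₃)).add ((hneg e he0).const_mul A₄)
    simpa using h1
  rw [UniformEdgeworthError, Metric.tendstoUniformly_iff]
  intro ε hε
  filter_upwards [hlim.eventually (gt_mem_nhds hε), eventually_gt_atTop 0] with n hn hn0 z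
  have hn' : (0 : ℝ) < n := by exact_mod_cast hn0
  rw [dist_comm, Real.dist_eq, sub_zero, abs_mul, abs_of_nonneg (by positivity)]
  refine lt_of_le_of_lt ?_ hn
  have hb := hbound (R + 3 * e) ((n : ℝ) ^ (-(R + 2 * e))) ((n : ℝ) ^ (-(R + e))) n hn0
    (by positivity) (by positivity) z
  have e1 : (√(n : ℝ) ^ (d - 1 + 1))⁻¹ = (n : ℝ) ^ (-((d : ℝ) / 2)) := by
    rw [Nat.sub_add_cancel (by omega), Real.rpow_neg hn'.le, Real.sqrt_eq_rpow,
      ← Real.rpow_mul_natCast hn'.le]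
    congr 2; ring
  have e2 : ((n : ℝ) ^ (-(R + 2 * e)) * (n : ℝ) ^ (R + 3 * e)) ^ 2 = (n : ℝ) ^ (2 * e) := by
    rw [← Real.rpow_add hn', ← Real.rpow_mul_natCast hn'.le]
    congr 1; push_cast; ring
  have e3 : ((n : ℝ) ^ (-(R + 2 * e)))⁻¹ = (n : ℝ) ^ (R + 2 * e) := by
    rw [Real.rpow_neg hn'.le, inv_inv]
  have e4 : -((n : ℝ) ^ (-(R + e))) ^ 2 / (2 * ((n : ℝ) ^ (-(R + 2 * e))) ^ 2) =
      -(1 / 2) * (n : ℝ) ^ (2 * e) := by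
    have : ((n : ℝ) ^ (-(R + e))) ^ 2 = (n : ℝ) ^ (2 * e) * ((n : ℝ) ^ (-(R + 2 * e))) ^ 2 := by
      rw [← Real.rpow_mul_natCast hn'.le, ← Real.rpow_mul_natCast hn'.le, ← Real.rpow_add hn']
      congr 1; push_cast; ring
    rw [this]
    field_simp
  rw [e1, e2, e3, e4] at hb
  have e5 : (n : ℝ) ^ R * (n : ℝ) ^ (-((d : ℝ) / 2)) = (n : ℝ) ^ (-((d : ℝ) / 2 - R)) := by
    rw [← Real.rpow_add hn']; congr 1; ring
  have e6 : (n : ℝ) ^ R * (n : ℝ) ^ (R + 2 * e) = (n : ℝ) ^ (2 * R + 2 * e) := by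
    rw [← Real.rpow_add hn']; congr 1; ring
  have e7 : (n : ℝ) ^ R * (n : ℝ) ^ (-(R + e)) = (n : ℝ) ^ (-e) := by
    rw [← Real.rpow_add hn']; congr 1; ring
  refine (mul_le_mul_of_nonneg_left hb (by positivity)).trans (le_of_eq ?_)
  rw [← e5, ← e6, ← e7, Real.rpow_one]
  ring

/-- The conclusions about generic vectors follow from the Diophantine property for all exponents
above `1 / (d - 1)`. -/
lemma edgeworth_of_forall_isDiophantine {d : ℕ} (hd : 2 ≤ d) {a p : Fin (d + 1) → ℝ}
    (hdio : ∀ β : ℝ, 1 / ((d : ℝ) - 1) < β → IsDiophantine β a) (h : IsCenteredParam a p)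
    {P : Fin (d - 1) → Polynomial ℝ} (hP : IsEdgeworthSeries (atomicLaw a p) P) :
    EdgeworthExpansionValid (atomicLaw a p) P ∧
      ∀ ε : ℝ, 0 < ε → UniformEdgeworthError (atomicLaw a p) P ((d : ℝ) / 2 - ε) := by
  have hd' : (2 : ℝ) ≤ d := by exact_mod_cast hd
  have hd1 : (0 : ℝ) < d - 1 := by linarith
  have key : ∀ ε : ℝ, 0 < ε → UniformEdgeworthError (atomicLaw a p) P ((d : ℝ) / 2 - ε) := by
    intro ε hε
    obtain ⟨β, hβ1, hβ2⟩ : ∃ β : ℝ, 1 / ((d : ℝ) - 1) < β ∧ ((d : ℝ) - 1 - 2 * ε) * β < 1 := by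
      have hlim : Tendsto (fun β : ℝ => ((d : ℝ) - 1 - 2 * ε) * β) (𝓝[>] (1 / ((d : ℝ) - 1)))
          (𝓝 (((d : ℝ) - 1 - 2 * ε) * (1 / ((d : ℝ) - 1)))) :=
        (tendsto_id.mono_left nhdsWithin_le_nhds).const_mul _
      have hlt : ((d : ℝ) - 1 - 2 * ε) * (1 / ((d : ℝ) - 1)) < 1 := by
        rw [mul_one_div, div_lt_one hd1]; linarith
      have hgt : ∀ᶠ β in 𝓝[>] (1 / ((d : ℝ) - 1)), 1 / ((d : ℝ) - 1) < β := self_mem_nhdsWithin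
      exact (hgt.and (hlim.eventually (gt_mem_nhds hlt))).exists
    refine uniformEdgeworthError_of_isDiophantine hd h (hdio β hβ1) ?_ hP
    calc 2 * ((d : ℝ) / 2 - ε - 1 / 2) * β = ((d : ℝ) - 1 - 2 * ε) * β := by ring
      _ < 1 := hβ2
  refine ⟨fun z => ?_, key⟩
  have h1 := (key (1 / 2) (by norm_num)).tendsto_at z
  have e : ((d - 1 : ℕ) : ℝ) / 2 = (d : ℝ) / 2 - 1 / 2 := by
    rw [Nat.cast_sub (by omega)]; push_cast; ring
  rw [e]
  exact h1

/-- A mean zero vector with prescribed differences to its first coordinate. -/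
lemma exists_mem_meanZeroSubspace {d : ℕ} {p : Fin (d + 1) → ℝ} (hp : ∑ i, p i = 1)
    (b : Fin d → ℝ) : ∃ x : meanZeroSubspace p, ∀ j : Fin d,
      (x : Fin (d + 1) → ℝ) j.succ - (x : Fin (d + 1) → ℝ) 0 = b j := by
  set u : Fin (d + 1) → ℝ := Fin.cons 0 b with hu
  refine ⟨⟨fun i => u i - ∑ k, p k * u k, ?_⟩, fun j => ?_⟩
  · simp only [meanZeroSubspace, LinearMap.mem_ker, LinearMap.sum_apply, LinearMap.smul_apply,
      LinearMap.proj_apply, smul_eq_mul, mul_sub, Finset.sum_sub_distrib, ← Finset.sum_mul, hp,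
      one_mul, sub_self]
  · simp [hu]

end

theorem mainTheorem1 (d : ℕ) (hd : 2 ≤ d) :
    -- the order `d - 1` Edgeworth series exists and is unique
    (∀ a p : Fin (d + 1) → ℝ, IsCenteredParam a p → (∃ i j, a i ≠ a j) →
      ∃! P : Fin (d - 1) → Polynomial ℝ, IsEdgeworthSeries (atomicLaw a p) P) ∧
    -- the expansion under the Diophantine condition
    (∀ (a p : Fin (d + 1) → ℝ) (β R : ℝ), IsCenteredParam a p → IsDiophantine β a →
      2 * (R - 1 / 2) * β < 1 →
      ∀ P : Fin (d - 1) → Polynomial ℝ, IsEdgeworthSeries (atomicLaw a p) P →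
        UniformEdgeworthError (atomicLaw a p) P R) ∧
    -- almost every `a` with respect to Lebesgue measure on `ℝ^{d+1}`, and all admissible `p`
    (∀ᵐ a : Fin (d + 1) → ℝ,
      (∀ β : ℝ, 1 / ((d : ℝ) - 1) < β → IsDiophantine β a) ∧
      ∀ p : Fin (d + 1) → ℝ, IsCenteredParam a p →
        ∀ P : Fin (d - 1) → Polynomial ℝ, IsEdgeworthSeries (atomicLaw a p) P →
          EdgeworthExpansionValid (atomicLaw a p) P ∧
          ∀ ε : ℝ, 0 < ε → UniformEdgeworthError (atomicLaw a p) P ((d : ℝ) / 2 - ε)) ∧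
    -- for fixed `p`, almost every `a` in the hyperplane of mean zero vectors
    (∀ p : Fin (d + 1) → ℝ, (∀ i, 0 < p i) → ∑ i, p i = 1 →
      ∀ᵐ a : meanZeroSubspace p ∂Measure.addHaar,
        (∀ β : ℝ, 1 / ((d : ℝ) - 1) < β → IsDiophantine β (a : Fin (d + 1) → ℝ)) ∧
        ∀ P : Fin (d - 1) → Polynomial ℝ, IsEdgeworthSeries (atomicLaw (a : Fin (d + 1) → ℝ) p) P →
          EdgeworthExpansionValid (atomicLaw (a : Fin (d + 1) → ℝ) p) P ∧
          ∀ ε : ℝ, 0 < ε →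
            UniformEdgeworthError (atomicLaw (a : Fin (d + 1) → ℝ) p) P ((d : ℝ) / 2 - ε)) := by
  refine ⟨fun a p h hne => existsUnique_isEdgeworthSeries h hne _,
    fun a p β R h hdio hR P hP => uniformEdgeworthError_of_isDiophantine hd h hdio hR hP, ?_, ?_⟩
  · have hae := ae_isDiophantine_of_surjective hd (volume : Measure (Fin (d + 1) → ℝ))
      LinearMap.id fun b => ⟨Fin.cons 0 b, fun j => by simp⟩
    filter_upwards [hae] with a ha
    exact ⟨ha, fun p h P hP => edgeworth_of_forall_isDiophantine hd ha h hP⟩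
  · intro p hp0 hp1
    have hae := ae_isDiophantine_of_surjective hd (Measure.addHaar : Measure (meanZeroSubspace p))
      (meanZeroSubspace p).subtype fun b => exists_mem_meanZeroSubspace hp1 b
    filter_upwards [hae] with a ha
    have hmean : ∑ i, p i * (a : Fin (d + 1) → ℝ) i = 0 := by
      simpa [meanZeroSubspace] using a.2
    exact ⟨ha, fun P hP => edgeworth_of_forall_isDiophantine hd ha ⟨hp0, hp1, hmean⟩ hP⟩
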